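/- Let $(X,d,\mu)$ be a metric space with a Borel measure, write $B(x,r)=\{y: d(x,y)<r\}$ and $V(x,r)=\mu(B(x,r))$, and suppose that $X$ is unbounded and AD-regular of dimension $n>0$: there is $C\ge 1$ with $C^{-1}r^n\le V(x,r)\le Cr^n$ for all $x\in X$ and $0<r<\operatorname{diam}(X)=\infty$. Let $X^+=X\times(0,\infty)$ with the measure $d\mu(y)\,dt/t$, let $L^0(X^+)$ be the space of measurable complex functions on $X^+$ (modulo null sets), and let $\Gamma(x)=\{(y,t)\in X^+: d(x,y)<t\}$. For $p,q\in(0,\infty)$, $s\in\mathbb R$ and $f\in L^0(X^+)$ put $$\|f\|_{T^{p,q}_s}=\Big(\int_X\Big(\iint_{\Gamma(x)}|V(y,t)^{-s}f(y,t)|^q\,\frac{d\mu(y)}{V(y,t)}\frac{dt}{t}\Big)^{p/q}d\mu(x)\Big)^{1/p},\qquad \|f\|_{L^q_s}=\Big(\iint_{X^+}|f|^q\,V(y,t)^{-qs}\,\frac{d\mu(y)}{V(y,t)}\frac{dt}{t}\Big)^{1/q},$$ and for $0\le a<b\le\infty$ let $f_{a,b}=\mathbf 1_{X\times(a,b)}f$.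 The real interpolation quasi-norm is $$\|g\|_{(L^q_{s_0},L^q_{s_1})_{\theta,p}}=\Big(\int_0^\infty\big(\alpha^{-\theta}K(\alpha,g)\big)^p\frac{d\alpha}{\alpha}\Big)^{1/p},\qquad K(\alpha,g)=\inf_{g=\varphi_0+\varphi_1}\big(\|\varphi_0\|_{L^q_{s_0}}+\alpha\|\varphi_1\|_{L^q_{s_1}}\big),$$ the infimum being over $\varphi_0,\varphi_1\in L^0(X^+)$. All these quantities take values in $[0,\infty]$. Let $p_0,p_1,q\in(0,\infty)$, $s_0\ne s_1$ in $\mathbb R$, $\theta\in(0,1)$ and $p_\theta^{-1}=(1-\theta)p_0^{-1}+\theta p_1^{-1}$. For $f\in L^0(X^+)$ put $$N(f)=\Big\|x\mapsto\|\mathbf 1_{\Gamma(x)}f\|_{(L^q_{s_0},L^q_{s_1})_{\theta,p_\theta}}\Big\|_{L^{p_\theta}(X)}.$$ Then the following equivalences hold for all $f\in L^0(X^+)$, with constants independent of $f$. (1) If $s_0<s_1$, then $$N(f)\simeq\Big\|\tau^{n(s_1-s_0)(1-\theta)}\|f_{\tau,\infty}\|_{T^{p_\theta,q}_{s_1}}\Big\|_{L^{p_\theta}(\mathbb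 R_+,d\tau/\tau)}\simeq\Big\|\tau^{-n(s_1-s_0)\theta}\|f_{0,\tau}\|_{T^{p_\theta,q}_{s_0}}\Big\|_{L^{p_\theta}(\mathbb R_+,d\tau/\tau)}.$$ (2) If $s_1<s_0$, the same holds with $(s_0,s_1,\theta)$ replaced by $(s_1,s_0,1-\theta)$ in the two truncation norms ($p_\theta$ unchanged), that is, $$N(f)\simeq\Big\|\tau^{n(s_0-s_1)\theta}\|f_{\tau,\infty}\|_{T^{p_\theta,q}_{s_0}}\Big\|_{L^{p_\theta}(\mathbb R_+,d\tau/\tau)}\simeq\Big\|\tau^{-n(s_0-s_1)(1-\theta)}\|f_{0,\tau}\|_{T^{p_\theta,q}_{s_1}}\Big\|_{L^{p_\theta}(\mathbb R_+,d\tau/\tau)}.$$ (3) In both cases, for every $r\in(1,\infty)$, with constants that may depend on $r$, $$N(f)\simeq_r\Big\|\big(r^{-nk\theta(s_1-s_0)}\,\|f_{r^{k-1},r^{k}}\|_{T^{p_\theta,q}_{s_0}}\big)_{k\in\mathbb Z}\Big\|_{\ell^{p_\theta}(\mathbb Z)}.$$ -/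

import Mathlib

open MeasureTheory Set Filter
open scoped ENNReal NNReal

noncomputable section

namespace TentSpace

variable {X : Type*} [MetricSpace X] [MeasurableSpace X]

/-- `(X, d, μ)` is Ahlfors–David regular of dimension `n`:
`C⁻¹ rⁿ ≤ μ (B(x, r)) ≤ C rⁿ` for all `x ∈ X` and `0 < r < diam X`. -/
def IsADRegular (μ : Measure X) (n : ℝ) : Prop :=
  0 < n ∧ ∃ C : ℝ, 1 ≤ C ∧ ∀ (x : X) (r : ℝ), 0 < r →
    ENNReal.ofReal r < Metric.ediam (univ : Set X) →
      ENNReal.ofReal (C⁻¹ * r ^ n) ≤ μ (Metric.ball x r) ∧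
        μ (Metric.ball x r) ≤ ENNReal.ofReal (C * r ^ n)

/-- The measure `dt / t` on `ℝ₊ = (0, ∞)`, regarded as a measure on `ℝ`. -/
def dtOverT : Measure ℝ :=
  (volume.restrict (Ioi (0 : ℝ))).withDensity fun t => ENNReal.ofReal t⁻¹

/-- The measure `dμ(y) dt / t` on the half-space `X⁺ = X × (0, ∞)`, regarded as a measure on
`X × ℝ`. -/
def halfSpace (μ : Measure X) : Measure (X × ℝ) :=
  μ.prod dtOverT

/-- `f ∈ L⁰(X⁺)`: the function `f` is (a.e. equal to) a measurable function on the half-space. -/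
def MemL0 (μ : Measure X) (f : X × ℝ → ℂ) : Prop :=
  AEStronglyMeasurable f (halfSpace μ)

/-- The `Lᵖ(ν)` quasi-norm `(∫ gᵖ dν)^(1/p)`, for `p ∈ (0, ∞)`, of a `[0, ∞]`-valued function. -/
def lpNorm {Z : Type*} [MeasurableSpace Z] (ν : Measure Z) (p : ℝ) (g : Z → ℝ≥0∞) : ℝ≥0∞ :=
  (∫⁻ z, g z ^ p ∂ν) ^ (1 / p)

/-- The cone `Γ(x) = {(y, t) ∈ X⁺ : d(x, y) < t}`. -/
def cone (x : X) : Set (X × ℝ) :=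
  {z | 0 < z.2 ∧ z.1 ∈ Metric.ball x z.2}

/-- The operator `V^s`, `(V^s f)(y, t) = V(y, t)^s f(y, t)`, where `V(y, t) = μ (B(y, t))`. -/
def volPow (μ : Measure X) (s : ℝ) (f : X × ℝ → ℂ) : X × ℝ → ℂ :=
  fun z => ((μ.real (Metric.ball z.1 z.2) ^ s : ℝ) : ℂ) * f z

/-- The Lusin-type functional
`A^q f(x) = (∬_{Γ(x)} |f(y, t)|^q dμ(y) / V(y, t) dt / t)^(1/q)`. -/
def lusin (μ : Measure X) (q : ℝ) (f : X × ℝ → ℂ) (x : X) : ℝ≥0∞ :=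
  (∫⁻ z in cone x, ‖f z‖ₑ ^ q / μ (Metric.ball z.1 z.2) ∂(halfSpace μ)) ^ (1 / q)

/-- The quasi-norm of the weighted tent space `T^{p,q}_s`, namely `‖A^q (V^{-s} f)‖_{Lᵖ(X)}`
(equal to `∞` for `f` outside that space). -/
def tentNorm (μ : Measure X) (p q s : ℝ) (f : X × ℝ → ℂ) : ℝ≥0∞ :=
  lpNorm μ p (lusin μ q (volPow μ (-s) f))

/-- The quasi-norm of
`L^q_s(X⁺) = L^q(X⁺, V(y, t)^{-qs} dμ(y) / V(y, t) dt / t)` (`∞` outside the space). -/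
def lqsNorm (μ : Measure X) (q s : ℝ) (g : X × ℝ → ℂ) : ℝ≥0∞ :=
  (∫⁻ z, ‖g z‖ₑ ^ q * μ (Metric.ball z.1 z.2) ^ (-q * s - 1) ∂(halfSpace μ)) ^ (1 / q)

/-- Peetre's `K`-functional
`K(α, g; A₀, A₁) = inf {‖φ₀‖_{A₀} + α ‖φ₁‖_{A₁} : g = φ₀ + φ₁}` for two spaces `A₀, A₁ ⊆ L⁰(ν)`
given by their quasi-norms `N₀, N₁` (which are `∞` outside the spaces). -/
def kFunctional {Z : Type*} [MeasurableSpace Z] (ν : Measure Z) (N₀ N₁ : (Z → ℂ) → ℝ≥0∞)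
    (α : ℝ) (g : Z → ℂ) : ℝ≥0∞ :=
  ⨅ (φ₀ : Z → ℂ) (φ₁ : Z → ℂ) (_ : AEStronglyMeasurable φ₀ ν) (_ : AEStronglyMeasurable φ₁ ν)
    (_ : g =ᵐ[ν] φ₀ + φ₁), N₀ φ₀ + ENNReal.ofReal α * N₁ φ₁

/-- The quasi-norm of the real interpolation space `(A₀, A₁)_{θ,p}`:
`(∫₀^∞ (α^{-θ} K(α, g; A₀, A₁))^p dα / α)^(1/p)`. -/
def realInterpNorm {Z : Type*} [MeasurableSpace Z] (ν : Measure Z) (N₀ N₁ : (Z → ℂ) → ℝ≥0∞)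
    (θ p : ℝ) (g : Z → ℂ) : ℝ≥0∞ :=
  lpNorm dtOverT p fun α => ENNReal.ofReal (α ^ (-θ)) * kFunctional ν N₀ N₁ α g

/-- The truncation `f_{a,b} = 1_{X × (a, b)} f`, for `a, b ∈ [0, ∞]`. -/
def truncate (a b : ℝ≥0∞) (f : X × ℝ → ℂ) : X × ℝ → ℂ :=
  {z : X × ℝ | a < ENNReal.ofReal z.2 ∧ ENNReal.ofReal z.2 < b}.indicator f

/-- `‖ x ↦ ‖1_{Γ(x)} f‖_{(L^q_{s₀}(X⁺), L^q_{s₁}(X⁺))_{θ,p}} ‖_{Lᵖ(X)}`. -/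
def coneInterpNorm (μ : Measure X) (p q s₀ s₁ θ : ℝ) (f : X × ℝ → ℂ) : ℝ≥0∞ :=
  lpNorm μ p fun x =>
    realInterpNorm (halfSpace μ) (lqsNorm μ q s₀) (lqsNorm μ q s₁) θ p ((cone x).indicator f)

/-- `‖ τ^{n(s₁-s₀)(1-θ)} ‖f_{τ,∞}‖_{T^{p,q}_{s₁}} ‖_{Lᵖ(ℝ₊, dτ/τ)}`. -/
def upperTruncNorm (μ : Measure X) (n p q s₀ s₁ θ : ℝ) (f : X × ℝ → ℂ) : ℝ≥0∞ :=
  lpNorm dtOverT p fun τ =>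
    ENNReal.ofReal (τ ^ (n * (s₁ - s₀) * (1 - θ))) *
      tentNorm μ p q s₁ (truncate (ENNReal.ofReal τ) ∞ f)

/-- `‖ τ^{-n(s₁-s₀)θ} ‖f_{0,τ}‖_{T^{p,q}_{s₀}} ‖_{Lᵖ(ℝ₊, dτ/τ)}`. -/
def lowerTruncNorm (μ : Measure X) (n p q s₀ s₁ θ : ℝ) (f : X × ℝ → ℂ) : ℝ≥0∞ :=
  lpNorm dtOverT p fun τ =>
    ENNReal.ofReal (τ ^ (-(n * (s₁ - s₀) * θ))) *
      tentNorm μ p q s₀ (truncate 0 (ENNReal.ofReal τ) f)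

/-- `‖ (r^{-nkθ(s₁-s₀)} ‖f_{r^{k-1},r^k}‖_{T^{p,q}_{s₀}})_{k ∈ ℤ} ‖_{ℓᵖ(ℤ)}`. -/
def layerNorm (μ : Measure X) (n p q s₀ s₁ θ r : ℝ) (f : X × ℝ → ℂ) : ℝ≥0∞ :=
  (∑' k : ℤ, (ENNReal.ofReal (r ^ (-(n * k * θ * (s₁ - s₀)))) *
    tentNorm μ p q s₀
      (truncate (ENNReal.ofReal (r ^ (k - 1))) (ENNReal.ofReal (r ^ k)) f)) ^ p) ^ (1 / p)

/-- Equivalence `N ≃ M` of two `[0, ∞]`-valued quasi-norms on `L⁰(X⁺)`, with a constant that does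
not depend on the function. -/
def NormEquiv (μ : Measure X) (N M : (X × ℝ → ℂ) → ℝ≥0∞) : Prop :=
  ∃ C : ℝ≥0, 1 ≤ C ∧ ∀ f : X × ℝ → ℂ, MemL0 μ f → N f ≤ C * M f ∧ M f ≤ C * N f

end TentSpace

end

/-!
Write `σ = (1 - θ) s₀ + θ s₁`, and let `ν_x` be the image on the `t`-axis of the measure
`|f|^q V^{-qσ} dμ(y) / V dt / t` restricted to the cone `Γ(x)`. By Ahlfors–David regularity
`V(y, t) ≃ t ^ n`, so exchanging `s₀` or `s₁` for `σ` in a weight only costs a power of `t`.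
The `K`-functional of two weighted `L^q` spaces is the `L^q` norm for the pointwise minimum of the
weights. After the substitution `α = τ ^ (n (s₁ - s₀))` all the norms with a parameter `τ` become
`(∫_X ∫ (∫ φ(t / τ) dν_x(t)) ^ (p / q) dτ / τ dμ(x)) ^ (1 / p)`, for a function `φ` that decays
like a power at `0` and at `∞`: the minimum of two powers for the interpolation norm, a power cut
off at `1` for the truncations. A discrete convolution inequality shows that, up to constants, such
an expression does not depend on `φ`: its inner integral is the sum over `k` of the powers
`ν_x [r ^ k, r ^ (k + 1)) ^ (p / q)`, as for the norm over layers.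
-/

noncomputable section

namespace TentSpace

/-! ### Two-sided comparisons in `[0, ∞]` -/

/-- `a` and `b` agree up to the constant `C`; with `C` explicit, comparisons can be integrated and
summed without losing uniformity. -/
def Comparable (C : ℝ≥0) (a b : ℝ≥0∞) : Prop :=
  a ≤ C * b ∧ b ≤ C * a

namespace Comparable

variable {C D : ℝ≥0} {a b c d : ℝ≥0∞}

theorem refl (a : ℝ≥0∞) : Comparable 1 a a := by simp [Comparable]

theorem symm (h : Comparable C a b) : Comparable C b a := ⟨h.2, h.1⟩

theorem trans (h : Comparable C a b) (h' : Comparable D b c) : Comparable (C * D) a c := by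
  constructor
  · calc a ≤ C * (D * c) := h.1.trans (by gcongr; exact h'.1)
      _ = (C * D : ℝ≥0) * c := by push_cast; ring
  · calc c ≤ D * (C * a) := h'.2.trans (by gcongr; exact h.2)
      _ = (C * D : ℝ≥0) * a := by push_cast; ring

theorem mono (h : Comparable C a b) (hCD : C ≤ D) : Comparable D a b :=
  ⟨h.1.trans (by gcongr), h.2.trans (by gcongr)⟩

theorem mul (h : Comparable C a b) (h' : Comparable D c d) :
    Comparable (C * D) (a * c) (b * d) := by
  constructor
  · calc a * c ≤ (C * b) * (D * d) := mul_le_mul' h.1 h'.1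
      _ = (C * D : ℝ≥0) * (b * d) := by push_cast; ring
  · calc b * d ≤ (C * a) * (D * c) := mul_le_mul' h.2 h'.2
      _ = (C * D : ℝ≥0) * (a * c) := by push_cast; ring

theorem mul_left (h : Comparable C a b) (c : ℝ≥0∞) : Comparable C (c * a) (c * b) := by
  simpa only [one_mul] using (refl c).mul h

theorem const_mul {c : ℝ≥0} (hc : c ≠ 0) (a : ℝ≥0∞) : Comparable (max c c⁻¹) (c * a) a := by
  refine ⟨by gcongr; exact le_max_left _ _, ?_⟩
  calc a = (c⁻¹ : ℝ≥0) * (c * a) := by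
        rw [← mul_assoc, ← ENNReal.coe_mul, inv_mul_cancel₀ hc, ENNReal.coe_one, one_mul]
    _ ≤ (max c c⁻¹ : ℝ≥0) * (c * a) := by gcongr; exact le_max_right _ _

theorem min (h : Comparable C a b) (h' : Comparable D c d) :
    Comparable (max C D) (min a c) (min b d) := by
  have h₁ := h.mono (le_max_left C D)
  have h₂ := h'.mono (le_max_right C D)
  constructor <;> rw [mul_min]
  exacts [min_le_min h₁.1 h₂.1, min_le_min h₁.2 h₂.2]

theorem rpow_of_nonneg (h : Comparable C a b) {e : ℝ} (he : 0 ≤ e) :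
    Comparable (C ^ e) (a ^ e) (b ^ e) := by
  constructor <;> rw [ENNReal.coe_rpow_of_nonneg _ he, ← ENNReal.mul_rpow_of_nonneg _ _ he]
  exacts [ENNReal.rpow_le_rpow h.1 he, ENNReal.rpow_le_rpow h.2 he]

theorem inv (h : Comparable C a b) (hC : C ≠ 0) : Comparable C a⁻¹ b⁻¹ := by
  have inv_le {a b : ℝ≥0∞} (hab : a ≤ C * b) : b⁻¹ ≤ C * a⁻¹ := by
    have hC' : (C : ℝ≥0∞) ≠ 0 := ENNReal.coe_ne_zero.2 hC
    calc b⁻¹ = C * (C * b)⁻¹ := by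
          rw [ENNReal.mul_inv (Or.inl hC') (Or.inl ENNReal.coe_ne_top), ← mul_assoc,
            ENNReal.mul_inv_cancel hC' ENNReal.coe_ne_top, one_mul]
      _ ≤ C * a⁻¹ := by gcongr
  exact ⟨inv_le h.2, inv_le h.1⟩

theorem rpow (h : Comparable C a b) (hC : C ≠ 0) (e : ℝ) :
    Comparable (C ^ |e|) (a ^ e) (b ^ e) := by
  rcases le_total 0 e with he | he
  · rw [abs_of_nonneg he]
    exact h.rpow_of_nonneg he
  · have h_inv := (h.rpow_of_nonneg (neg_nonneg.2 he)).inv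
      (NNReal.rpow_pos (pos_iff_ne_zero.2 hC)).ne'
    simpa only [abs_of_nonpos he, ENNReal.rpow_neg, inv_inv] using h_inv

theorem lintegral {Z : Type*} [MeasurableSpace Z] {ν : Measure Z} {g h : Z → ℝ≥0∞}
    (H : ∀ᵐ z ∂ν, Comparable C (g z) (h z)) :
    Comparable C (∫⁻ z, g z ∂ν) (∫⁻ z, h z ∂ν) := by
  constructor <;> rw [← lintegral_const_mul' _ _ ENNReal.coe_ne_top]
  exacts [lintegral_mono_ae (H.mono fun z hz => hz.1), lintegral_mono_ae (H.mono fun z hz => hz.2)]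

theorem tsum {ι : Type*} {g h : ι → ℝ≥0∞} (H : ∀ i, Comparable C (g i) (h i)) :
    Comparable C (∑' i, g i) (∑' i, h i) := by
  constructor <;> rw [← ENNReal.tsum_mul_left]
  exacts [ENNReal.tsum_le_tsum fun i => (H i).1, ENNReal.tsum_le_tsum fun i => (H i).2]

end Comparable

section NormEquiv

variable {X : Type*} [MeasurableSpace X] {μ : Measure X} {N M K : (X × ℝ → ℂ) → ℝ≥0∞}

theorem normEquiv_of_comparable (C : ℝ≥0) (h : ∀ f, MemL0 μ f → Comparable C (N f) (M f)) :
    NormEquiv μ N M :=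
  ⟨max C 1, le_max_right _ _, fun f hf => (h f hf).mono (le_max_left _ _)⟩

theorem NormEquiv.symm (h : NormEquiv μ N M) : NormEquiv μ M N := by
  obtain ⟨C, hC, h⟩ := h
  exact ⟨C, hC, fun f hf => (h f hf).symm⟩

theorem NormEquiv.trans (h : NormEquiv μ N M) (h' : NormEquiv μ M K) : NormEquiv μ N K := by
  obtain ⟨C, -, h⟩ := h
  obtain ⟨D, -, h'⟩ := h'
  exact normEquiv_of_comparable (C * D) fun f hf => Comparable.trans (h f hf) (h' f hf)

end NormEquiv

/-! ### The measure `dt / t` -/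

theorem lintegral_dtOverT (h : ℝ → ℝ≥0∞) :
    ∫⁻ t, h t ∂dtOverT = ∫⁻ t in Ioi 0, ENNReal.ofReal t⁻¹ * h t := by
  rw [dtOverT, lintegral_withDensity_eq_lintegral_mul_non_measurable _ (by fun_prop)
    (Eventually.of_forall fun _ => ENNReal.ofReal_lt_top)]
  rfl

theorem ae_dtOverT_pos : ∀ᵐ t ∂dtOverT, 0 < t :=
  (withDensity_absolutelyContinuous _ _).ae_le (ae_restrict_mem measurableSet_Ioi)

theorem ae_dtOverT_ne (c : ℝ) : ∀ᵐ t ∂dtOverT, t ≠ c :=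
  ((withDensity_absolutelyContinuous _ _).trans Measure.absolutelyContinuous_restrict).ae_le
    (compl_mem_ae_iff.2 (measure_singleton c))

instance : SigmaFinite dtOverT := by
  unfold dtOverT
  infer_instance

theorem dtOverT_Ico {a b : ℝ} (ha : 0 < a) (hab : a ≤ b) :
    dtOverT (Ico a b) = ENNReal.ofReal (Real.log (b / a)) := by
  have h_nonneg : 0 ≤ᵐ[volume.restrict (Ioc a b)] fun t : ℝ => t⁻¹ :=
    (ae_restrict_mem measurableSet_Ioc).mono fun t ht => inv_nonneg.2 (ha.trans ht.1).le
  have h_integrable : IntegrableOn (fun t : ℝ => t⁻¹) (Ioc a b) := by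
    rw [← intervalIntegrable_iff_integrableOn_Ioc_of_le hab, intervalIntegrable_inv_iff]
    exact Or.inr (notMem_uIcc_of_lt ha (ha.trans_le hab))
  have hsub : Ico a b ⊆ Ioi 0 := fun t ht => ha.trans_le ht.1
  rw [dtOverT, withDensity_apply _ measurableSet_Ico, Measure.restrict_restrict_of_subset hsub,
    ← integral_inv_of_pos ha (ha.trans_le hab), intervalIntegral.integral_of_le hab,
    ofReal_integral_eq_lintegral_ofReal h_integrable h_nonneg,
    Measure.restrict_congr_set Ico_ae_eq_Ioc]

theorem lintegral_dtOverT_comp_rpow {δ : ℝ} (hδ : δ ≠ 0) (h : ℝ → ℝ≥0∞) :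
    ∫⁻ α, h α ∂dtOverT = ENNReal.ofReal |δ| * ∫⁻ τ, h (τ ^ δ) ∂dtOverT := by
  have h_image : (fun τ : ℝ => τ ^ δ) '' Ioi 0 = Ioi 0 := by
    ext α
    constructor
    · rintro ⟨τ, hτ, rfl⟩
      exact Real.rpow_pos_of_pos hτ δ
    · intro hα
      exact ⟨α ^ δ⁻¹, Real.rpow_pos_of_pos hα _, Real.rpow_inv_rpow (le_of_lt hα) hδ⟩
  have h_inj : InjOn (fun τ : ℝ => τ ^ δ) (Ioi 0) :=
    (Real.rpow_left_injOn hδ).mono Ioi_subset_Ici_self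
  rw [lintegral_dtOverT, lintegral_dtOverT, ← lintegral_const_mul' _ _ ENNReal.ofReal_ne_top]
  conv_lhs => rw [← h_image]
  rw [lintegral_image_eq_lintegral_abs_deriv_mul measurableSet_Ioi
    (fun τ hτ => (Real.hasDerivAt_rpow_const (Or.inl (ne_of_gt hτ))).hasDerivWithinAt) h_inj]
  refine setLIntegral_congr_fun measurableSet_Ioi fun τ hτ => ?_
  have hτ : 0 < τ := hτ
  have h_density : |δ * τ ^ (δ - 1)| * (τ ^ δ)⁻¹ = |δ| * τ⁻¹ := by
    rw [abs_mul, abs_of_pos (Real.rpow_pos_of_pos hτ _), Real.rpow_sub_one hτ.ne', mul_assoc,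
      mul_comm_div, div_eq_mul_inv, mul_inv_cancel_left₀ (Real.rpow_pos_of_pos hτ δ).ne']
  rw [← mul_assoc, ← mul_assoc, ← ENNReal.ofReal_mul (abs_nonneg _),
    ← ENNReal.ofReal_mul (abs_nonneg _), h_density]

/-! ### Geometric layers -/

section Layers

variable {r : ℝ}

theorem iUnion_Ico_zpow (hr : 1 < r) : ⋃ k : ℤ, Ico (r ^ k) (r ^ (k + 1)) = Ioi 0 := by
  ext t
  simp only [mem_iUnion, mem_Ioi]
  exact ⟨fun ⟨k, hk⟩ => (zpow_pos (by positivity) k).trans_le hk.1,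
    fun ht => exists_mem_Ico_zpow ht hr⟩

theorem lintegral_eq_tsum_Ico_zpow (hr : 1 < r) {ν : Measure ℝ} (hν : ∀ᵐ t ∂ν, 0 < t)
    (h : ℝ → ℝ≥0∞) :
    ∫⁻ t, h t ∂ν = ∑' k : ℤ, ∫⁻ t in Ico (r ^ k) (r ^ (k + 1)), h t ∂ν := by
  have h_disjoint : Pairwise (Function.onFun Disjoint fun k : ℤ => Ico (r ^ k) (r ^ (k + 1))) :=
    (zpow_right_mono₀ hr.le).pairwise_disjoint_on_Ico_succ
  rw [← lintegral_iUnion (fun _ => measurableSet_Ico) h_disjoint, iUnion_Ico_zpow hr,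
    Measure.restrict_eq_self_of_ae_mem (s := Ioi 0) hν]

theorem div_mem_Ioo_of_mem_Ico_zpow (hr : 1 < r) {j k : ℤ} {t τ : ℝ}
    (ht : t ∈ Ico (r ^ j) (r ^ (j + 1))) (hτ : τ ∈ Ico (r ^ k) (r ^ (k + 1))) :
    t / τ ∈ Ioo (r ^ (j - k - 1)) (r ^ (j - k + 1)) := by
  have hr0 : 0 < r := by positivity
  have hτ0 : 0 < τ := (zpow_pos hr0 k).trans_le hτ.1
  constructor
  · calc r ^ (j - k - 1) = r ^ j / r ^ (k + 1) := by rw [← zpow_sub₀ hr0.ne', sub_sub]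
      _ < t / τ := div_lt_div₀' ht.1 hτ.2 ((zpow_pos hr0 j).trans_le ht.1) hτ0
  · calc t / τ < r ^ (j + 1) / r ^ k := div_lt_div₀ ht.2 hτ.1 (zpow_pos hr0 _).le (zpow_pos hr0 k)
      _ = r ^ (j - k + 1) := by rw [← zpow_sub₀ hr0.ne', sub_add_eq_add_sub]

theorem dtOverT_Ico_zpow (hr : 1 < r) (k : ℤ) :
    dtOverT (Ico (r ^ k) (r ^ (k + 1))) = ENNReal.ofReal (Real.log r) := by
  have hr0 : 0 < r := by positivity
  rw [dtOverT_Ico (zpow_pos hr0 k) (zpow_right_mono₀ hr.le (by lia)), ← zpow_sub₀ hr0.ne',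
    add_sub_cancel_left, zpow_one]

theorem lintegral_dtOverT_le_tsum (hr : 1 < r) {F : ℝ → ℝ≥0∞} {G : ℤ → ℝ≥0∞}
    (h : ∀ k, ∀ τ ∈ Ico (r ^ k) (r ^ (k + 1)), F τ ≤ G k) :
    ∫⁻ τ, F τ ∂dtOverT ≤ ENNReal.ofReal (Real.log r) * ∑' k, G k := by
  rw [lintegral_eq_tsum_Ico_zpow hr ae_dtOverT_pos, ← ENNReal.tsum_mul_left]
  refine ENNReal.tsum_le_tsum fun k => (setLIntegral_mono' measurableSet_Ico (h k)).trans_eq ?_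
  rw [setLIntegral_const, dtOverT_Ico_zpow hr, mul_comm]

theorem tsum_le_lintegral_dtOverT (hr : 1 < r) {F : ℝ → ℝ≥0∞} {G : ℤ → ℝ≥0∞}
    (h : ∀ k, ∀ τ ∈ Ico (r ^ k) (r ^ (k + 1)), G k ≤ F τ) :
    ENNReal.ofReal (Real.log r) * ∑' k, G k ≤ ∫⁻ τ, F τ ∂dtOverT := by
  rw [lintegral_eq_tsum_Ico_zpow hr ae_dtOverT_pos, ← ENNReal.tsum_mul_left]
  refine ENNReal.tsum_le_tsum fun k => Eq.trans_le ?_ (setLIntegral_mono' measurableSet_Ico (h k))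
  rw [setLIntegral_const, dtOverT_Ico_zpow hr, mul_comm]

end Layers

/-! ### A discrete convolution inequality -/

/-- This replaces Hölder's inequality, and holds for `P < 1` as well: each `x j` is at most
`(∑ x ^ P) ^ (1 / P)`. -/
theorem tsum_mul_rpow_le {ι : Type*} (b x : ι → ℝ≥0∞) {P : ℝ} (hP : 0 < P) :
    (∑' j, b j * x j) ^ P ≤ (∑' j, b j) ^ P * ∑' j, x j ^ P := by
  have h_term (j : ι) : x j ≤ (∑' j, x j ^ P) ^ P⁻¹ := by
    rw [ENNReal.le_rpow_inv_iff hP]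
    exact ENNReal.le_tsum j
  calc (∑' j, b j * x j) ^ P ≤ (∑' j, b j * (∑' j, x j ^ P) ^ P⁻¹) ^ P := by
        gcongr with j
        exact h_term j
    _ = (∑' j, b j) ^ P * ∑' j, x j ^ P := by
        rw [ENNReal.tsum_mul_right, ENNReal.mul_rpow_of_nonneg _ _ hP.le,
          ENNReal.rpow_inv_rpow hP.ne']

theorem tsum_pow_natAbs_ne_top {β : ℝ≥0} (hβ : β < 1) :
    ∑' i : ℤ, (β : ℝ≥0∞) ^ i.natAbs ≠ ∞ := by
  have h_summable : Summable fun i : ℤ => β ^ i.natAbs := by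
    rw [← NNReal.summable_coe, summable_int_iff_summable_nat_and_neg]
    have h_geom := summable_geometric_of_lt_one β.2 (by exact_mod_cast hβ)
    constructor <;> simpa using h_geom
  simpa only [ENNReal.coe_pow] using ENNReal.tsum_coe_ne_top_iff_summable.2 h_summable

theorem exists_tsum_convolution_rpow_le {ρ : ℝ≥0} (hρ : ρ < 1) {P : ℝ} (hP : 0 < P) :
    ∃ C : ℝ≥0, ∀ m : ℤ → ℝ≥0∞,
      ∑' k, (∑' j, (ρ : ℝ≥0∞) ^ (j - k).natAbs * m j) ^ P ≤ C * ∑' j, m j ^ P := by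
  -- Half of the decay of `ρ ^ |j - k|` pays for the inner sum, the other half for the outer one.
  obtain ⟨β, rfl⟩ : ∃ β : ℝ≥0, β * β = ρ := ⟨NNReal.sqrt ρ, NNReal.mul_self_sqrt ρ⟩
  have hβ : β < 1 := lt_of_not_ge fun h => hρ.not_ge (one_le_mul h h)
  lift ∑' i : ℤ, (β : ℝ≥0∞) ^ i.natAbs to ℝ≥0 using tsum_pow_natAbs_ne_top hβ with S hS
  lift ∑' i : ℤ, ((β ^ P : ℝ≥0) : ℝ≥0∞) ^ i.natAbs to ℝ≥0
    using tsum_pow_natAbs_ne_top (NNReal.rpow_lt_one hβ hP) with S' hS'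
  refine ⟨S ^ P * S', fun m => ?_⟩
  have h_inner (k : ℤ) : (∑' j, ((β * β : ℝ≥0) : ℝ≥0∞) ^ (j - k).natAbs * m j) ^ P
      ≤ S ^ P * ∑' j, ((β ^ P : ℝ≥0) : ℝ≥0∞) ^ (j - k).natAbs * m j ^ P := by
    have h_shift : ∑' j : ℤ, (β : ℝ≥0∞) ^ (j - k).natAbs = S :=
      hS ▸ (Equiv.subRight k).tsum_eq fun i : ℤ => (β : ℝ≥0∞) ^ i.natAbs
    convert tsum_mul_rpow_le (fun j => (β : ℝ≥0∞) ^ (j - k).natAbs)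
      (fun j => (β : ℝ≥0∞) ^ (j - k).natAbs * m j) hP using 4 with j j
    · rw [ENNReal.coe_mul, mul_pow, mul_assoc]
    · exact h_shift.symm
    · rw [ENNReal.mul_rpow_of_nonneg _ _ hP.le, ENNReal.coe_rpow_of_nonneg _ hP.le,
        ← ENNReal.rpow_mul_natCast, ← ENNReal.rpow_natCast_mul, mul_comm P]
  have h_outer (j : ℤ) : ∑' k : ℤ, ((β ^ P : ℝ≥0) : ℝ≥0∞) ^ (j - k).natAbs = S' :=
    hS' ▸ (Equiv.subLeft j).tsum_eq fun i : ℤ => ((β ^ P : ℝ≥0) : ℝ≥0∞) ^ i.natAbs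
  calc ∑' k, (∑' j, ((β * β : ℝ≥0) : ℝ≥0∞) ^ (j - k).natAbs * m j) ^ P
      ≤ ∑' k, S ^ P * ∑' j, ((β ^ P : ℝ≥0) : ℝ≥0∞) ^ (j - k).natAbs * m j ^ P :=
        ENNReal.tsum_le_tsum h_inner
    _ = S ^ P * ∑' j, ∑' k, ((β ^ P : ℝ≥0) : ℝ≥0∞) ^ (j - k).natAbs * m j ^ P := by
        rw [ENNReal.tsum_mul_left, ENNReal.tsum_comm]
    _ = (S ^ P * S' : ℝ≥0) * ∑' j, m j ^ P := by
        simp only [ENNReal.tsum_mul_right, h_outer, ENNReal.tsum_mul_left]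
        rw [ENNReal.coe_mul, ENNReal.coe_rpow_of_nonneg _ hP.le, mul_assoc]

/-! ### Averages over dilated kernels -/

/-- A weight `φ` on `(0, ∞)` for which the averages `τ ↦ ∫ φ (t / τ) dν(t)` see, up to constants,
exactly the masses `ν [r ^ k, r ^ (k + 1))`: it is dominated by a power of `min u u⁻¹`, and bounded
below on the set of all quotients `t / τ` of elements of two fixed layers. -/
structure IsLayerKernel (r : ℝ) (φ : ℝ → ℝ≥0∞) : Prop where
  measurable : Measurable φ
  exists_le_exp : ∃ ε > 0, ∀ u > 0, φ u ≤ ENNReal.ofReal (Real.exp (-(ε * |Real.log u|)))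
  exists_ge : ∃ η : ℝ≥0, η ≠ 0 ∧ ∃ i : ℤ, ∀ u ∈ Ioo (r ^ (i - 1)) (r ^ (i + 1)), η ≤ φ u

section Kernels

variable {r a b u : ℝ} {φ : ℝ → ℝ≥0∞}

theorem mem_Ioo_zpow_iff (hr : 1 < r) {i : ℤ} (hu : 0 < u) :
    u ∈ Ioo (r ^ (i - 1)) (r ^ (i + 1)) ↔ |Real.log u - i * Real.log r| < Real.log r := by
  have hr0 : 0 < r := by positivity
  rw [mem_Ioo, ← Real.log_lt_log_iff (zpow_pos hr0 _) hu, ← Real.log_lt_log_iff hu (zpow_pos hr0 _),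
    Real.log_zpow, Real.log_zpow, abs_sub_lt_iff]
  push_cast
  constructor <;> rintro ⟨h₁, h₂⟩ <;> constructor <;> linarith

theorem IsLayerKernel.exists_le_mul_pow_natAbs (h : IsLayerKernel r φ) (hr : 1 < r) :
    ∃ D ρ : ℝ≥0, ρ < 1 ∧ ∀ (i : ℤ), ∀ u ∈ Ioo (r ^ (i - 1)) (r ^ (i + 1)),
      φ u ≤ D * (ρ : ℝ≥0∞) ^ i.natAbs := by
  obtain ⟨ε, hε, hφ⟩ := h.exists_le_exp
  have hr0 : 0 < r := by positivity
  have hlog : 0 < Real.log r := Real.log_pos hr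
  refine ⟨(Real.exp (ε * Real.log r)).toNNReal, (Real.exp (-(ε * Real.log r))).toNNReal, ?_,
    fun i u hu => ?_⟩
  · rw [Real.toNNReal_lt_one, Real.exp_lt_one_iff]
    exact neg_neg_of_pos (mul_pos hε hlog)
  have hu0 : 0 < u := (zpow_pos hr0 _).trans hu.1
  have h_abs : i.natAbs * Real.log r ≤ |Real.log u| + Real.log r := by
    have h_near := (mem_Ioo_zpow_iff hr hu0).1 hu
    calc i.natAbs * Real.log r = |i * Real.log r| := by
          rw [abs_mul, abs_of_pos hlog, Nat.cast_natAbs, Int.cast_abs]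
      _ ≤ |Real.log u| + |Real.log u - i * Real.log r| := by
          simpa only [sub_sub_cancel] using abs_sub (Real.log u) (Real.log u - i * Real.log r)
      _ ≤ |Real.log u| + Real.log r := by gcongr
  calc φ u ≤ ENNReal.ofReal (Real.exp (-(ε * |Real.log u|))) := hφ u hu0
    _ ≤ ENNReal.ofReal (Real.exp (ε * Real.log r) * Real.exp (-(ε * Real.log r)) ^ i.natAbs) := by
        refine ENNReal.ofReal_le_ofReal ?_
        rw [← Real.exp_nat_mul, ← Real.exp_add, Real.exp_le_exp]
        nlinarith
    _ = _ := by
        rw [ENNReal.ofReal_mul (by positivity), ENNReal.ofReal_pow (by positivity)]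
        rfl

theorem IsLayerKernel.exists_lintegral_le (h : IsLayerKernel r φ) (hr : 1 < r) :
    ∃ D ρ : ℝ≥0, ρ < 1 ∧ ∀ ν : Measure ℝ, (∀ᵐ t ∂ν, 0 < t) →
      ∀ k : ℤ, ∀ τ ∈ Ico (r ^ k) (r ^ (k + 1)), ∫⁻ t, φ (t / τ) ∂ν
        ≤ D * ∑' j : ℤ, (ρ : ℝ≥0∞) ^ (j - k).natAbs * ν (Ico (r ^ j) (r ^ (j + 1))) := by
  obtain ⟨D, ρ, hρ, hφ⟩ := h.exists_le_mul_pow_natAbs hr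
  refine ⟨D, ρ, hρ, fun ν hν k τ hτ => ?_⟩
  rw [lintegral_eq_tsum_Ico_zpow hr hν, ← ENNReal.tsum_mul_left]
  refine ENNReal.tsum_le_tsum fun j => ?_
  rw [← mul_assoc, ← setLIntegral_const]
  exact setLIntegral_mono' measurableSet_Ico fun t ht =>
    hφ _ _ (div_mem_Ioo_of_mem_Ico_zpow hr ht hτ)

theorem IsLayerKernel.exists_le_lintegral (h : IsLayerKernel r φ) (hr : 1 < r) :
    ∃ η : ℝ≥0, η ≠ 0 ∧ ∃ i : ℤ, ∀ ν : Measure ℝ, ∀ k : ℤ, ∀ τ ∈ Ico (r ^ k) (r ^ (k + 1)),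
      η * ν (Ico (r ^ (k + i)) (r ^ (k + i + 1))) ≤ ∫⁻ t, φ (t / τ) ∂ν := by
  obtain ⟨η, hη, i, hφ⟩ := h.exists_ge
  refine ⟨η, hη, i, fun ν k τ hτ => ?_⟩
  rw [← setLIntegral_const]
  refine (setLIntegral_mono' measurableSet_Ico fun t ht => hφ _ ?_).trans
    (setLIntegral_le_lintegral _ _)
  simpa only [add_sub_cancel_left] using div_mem_Ioo_of_mem_Ico_zpow hr ht hτ

theorem IsLayerKernel.exists_lintegral_rpow_le (h : IsLayerKernel r φ) (hr : 1 < r) {P : ℝ}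
    (hP : 0 < P) :
    ∃ C : ℝ≥0, ∀ ν : Measure ℝ, (∀ᵐ t ∂ν, 0 < t) →
      ∫⁻ τ, (∫⁻ t, φ (t / τ) ∂ν) ^ P ∂dtOverT
        ≤ C * ∑' k : ℤ, ν (Ico (r ^ k) (r ^ (k + 1))) ^ P := by
  obtain ⟨D, ρ, hρ, h_le⟩ := h.exists_lintegral_le hr
  obtain ⟨C, hC⟩ := exists_tsum_convolution_rpow_le hρ hP
  refine ⟨(Real.log r).toNNReal * (D ^ P * C), fun ν hν => ?_⟩
  calc ∫⁻ τ, (∫⁻ t, φ (t / τ) ∂ν) ^ P ∂dtOverT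
      ≤ ENNReal.ofReal (Real.log r) * ∑' k : ℤ,
          (D * ∑' j : ℤ, (ρ : ℝ≥0∞) ^ (j - k).natAbs * ν (Ico (r ^ j) (r ^ (j + 1)))) ^ P :=
        lintegral_dtOverT_le_tsum hr fun k τ hτ => ENNReal.rpow_le_rpow (h_le ν hν k τ hτ) hP.le
    _ ≤ ENNReal.ofReal (Real.log r) *
          (D ^ P * (C * ∑' k : ℤ, ν (Ico (r ^ k) (r ^ (k + 1))) ^ P)) := by
        simp only [ENNReal.mul_rpow_of_nonneg _ _ hP.le, ENNReal.tsum_mul_left]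
        gcongr
        exact hC _
    _ = _ := by
        push_cast [ENNReal.coe_rpow_of_nonneg _ hP.le, ENNReal.ofReal]
        ring

theorem IsLayerKernel.exists_tsum_rpow_le (h : IsLayerKernel r φ) (hr : 1 < r) {P : ℝ}
    (hP : 0 < P) :
    ∃ C : ℝ≥0, ∀ ν : Measure ℝ, ∑' k : ℤ, ν (Ico (r ^ k) (r ^ (k + 1))) ^ P
      ≤ C * ∫⁻ τ, (∫⁻ t, φ (t / τ) ∂ν) ^ P ∂dtOverT := by
  obtain ⟨η, hη, i, h_ge⟩ := h.exists_le_lintegral hr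
  set L : ℝ≥0 := (Real.log r).toNNReal * η ^ P with hL_def
  have hL : L ≠ 0 := mul_ne_zero (Real.toNNReal_pos.2 (Real.log_pos hr)).ne'
    (NNReal.rpow_pos (pos_iff_ne_zero.2 hη)).ne'
  refine ⟨L⁻¹, fun ν => ?_⟩
  rw [ENNReal.coe_inv hL, mul_comm, ← div_eq_mul_inv, ENNReal.le_div_iff_mul_le
    (Or.inl (ENNReal.coe_ne_zero.2 hL)) (Or.inl ENNReal.coe_ne_top), mul_comm, hL_def,
    ENNReal.coe_mul, mul_assoc, ← ENNReal.tsum_mul_left, ← (Equiv.addRight i).tsum_eq]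
  refine tsum_le_lintegral_dtOverT hr fun k τ hτ => ?_
  rw [ENNReal.coe_rpow_of_nonneg _ hP.le, ← ENNReal.mul_rpow_of_nonneg _ _ hP.le]
  exact ENNReal.rpow_le_rpow (h_ge ν k τ hτ) hP.le

theorem IsLayerKernel.exists_comparable (h : IsLayerKernel r φ) (hr : 1 < r) {P : ℝ} (hP : 0 < P) :
    ∃ C : ℝ≥0, ∀ ν : Measure ℝ, (∀ᵐ t ∂ν, 0 < t) →
      Comparable C (∫⁻ τ, (∫⁻ t, φ (t / τ) ∂ν) ^ P ∂dtOverT)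
        (∑' k : ℤ, ν (Ico (r ^ k) (r ^ (k + 1))) ^ P) := by
  obtain ⟨C, hC⟩ := h.exists_lintegral_rpow_le hr hP
  obtain ⟨D, hD⟩ := h.exists_tsum_rpow_le hr hP
  exact ⟨max C D, fun ν hν => ⟨(hC ν hν).trans (by gcongr; exact le_max_left C D),
    (hD ν).trans (by gcongr; exact le_max_right C D)⟩⟩

theorem exp_neg_abs_mul_le_rpow (a : ℝ) {M : ℝ} (hu : 0 < u) (hM : |Real.log u| ≤ M) :
    Real.exp (-(|a| * M)) ≤ u ^ a := by
  rw [Real.rpow_def_of_pos hu, Real.exp_le_exp]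
  calc -(|a| * M) ≤ -|a * Real.log u| := by rw [abs_mul]; gcongr
    _ ≤ Real.log u * a := by rw [mul_comm]; exact neg_abs_le _

theorem rpow_le_exp_neg_abs_mul (hu : 0 < u) (h : a * Real.log u ≤ 0) :
    u ^ a ≤ Real.exp (-(|a| * |Real.log u|)) := by
  rw [Real.rpow_def_of_pos hu, Real.exp_le_exp, ← abs_mul, abs_of_nonpos h, neg_neg, mul_comm]

theorem abs_log_le_of_mem_Ioo_zpow (hr : 1 < r) {i : ℤ}
    (hu : u ∈ Ioo (r ^ (i - 1)) (r ^ (i + 1))) :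
    |Real.log u| ≤ |i * Real.log r| + Real.log r := by
  have hu0 : 0 < u := (zpow_pos (by positivity) _).trans hu.1
  have h_near := (mem_Ioo_zpow_iff hr hu0).1 hu
  linarith [abs_sub_abs_le_abs_sub (Real.log u) (i * Real.log r)]

theorem isLayerKernel_indicator {S : Set ℝ} (hS : MeasurableSet S) (hr : 1 < r) (ha : a ≠ 0)
    (h_neg : ∀ u ∈ S, 0 < u → a * Real.log u ≤ 0) {i : ℤ}
    (hi : Ioo (r ^ (i - 1)) (r ^ (i + 1)) ⊆ S) :
    IsLayerKernel r (S.indicator fun u => ENNReal.ofReal (u ^ a)) where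
  measurable := Measurable.indicator (by fun_prop) hS
  exists_le_exp := ⟨|a|, abs_pos.2 ha, fun u hu => indicator_apply_le' (fun huS =>
    ENNReal.ofReal_le_ofReal (rpow_le_exp_neg_abs_mul hu (h_neg u huS hu))) fun _ => zero_le⟩
  exists_ge := by
    refine ⟨(Real.exp (-(|a| * (|i * Real.log r| + Real.log r)))).toNNReal,
      (Real.toNNReal_pos.2 (Real.exp_pos _)).ne', i, fun u hu => ?_⟩
    rw [indicator_of_mem (hi hu)]
    exact ENNReal.ofReal_le_ofReal (exp_neg_abs_mul_le_rpow a
      ((zpow_pos (by positivity) _).trans hu.1) (abs_log_le_of_mem_Ioo_zpow hr hu))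

theorem isLayerKernel_indicator_Iio (hr : 1 < r) (ha : 0 < a) :
    IsLayerKernel r ((Iio 1).indicator fun u => ENNReal.ofReal (u ^ a)) :=
  isLayerKernel_indicator measurableSet_Iio hr ha.ne' (i := -1)
    (fun _ hu1 hu => mul_nonpos_of_nonneg_of_nonpos ha.le (Real.log_nonpos hu.le (le_of_lt hu1)))
    fun u hu => by simpa using hu.2

theorem isLayerKernel_indicator_Ioi (hr : 1 < r) (ha : a < 0) :
    IsLayerKernel r ((Ioi 1).indicator fun u => ENNReal.ofReal (u ^ a)) :=
  isLayerKernel_indicator measurableSet_Ioi hr ha.ne (i := 1)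
    (fun _ hu1 _ => mul_nonpos_of_nonpos_of_nonneg ha.le (Real.log_nonneg (le_of_lt hu1)))
    fun u hu => by simpa using hu.1

theorem isLayerKernel_min_rpow (hr : 1 < r) (hab : a * b < 0) :
    IsLayerKernel r fun u => min (ENNReal.ofReal (u ^ a)) (ENNReal.ofReal (u ^ b)) where
  measurable := by fun_prop
  exists_le_exp := by
    have ha : a ≠ 0 := left_ne_zero_of_mul hab.ne
    have hb : b ≠ 0 := right_ne_zero_of_mul hab.ne
    refine ⟨min |a| |b|, lt_min (abs_pos.2 ha) (abs_pos.2 hb), fun u hu => ?_⟩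
    rcases le_or_gt (a * Real.log u) 0 with h | h
    · refine (min_le_left _ _).trans (ENNReal.ofReal_le_ofReal ?_)
      refine (rpow_le_exp_neg_abs_mul hu h).trans (Real.exp_le_exp.2 ?_)
      gcongr
      exact min_le_left _ _
    · have h' : b * Real.log u ≤ 0 := by nlinarith [mul_self_nonneg (Real.log u)]
      refine (min_le_right _ _).trans (ENNReal.ofReal_le_ofReal ?_)
      refine (rpow_le_exp_neg_abs_mul hu h').trans (Real.exp_le_exp.2 ?_)
      gcongr
      exact min_le_right _ _
  exists_ge := by
    refine ⟨(min (Real.exp (-(|a| * Real.log r))) (Real.exp (-(|b| * Real.log r)))).toNNReal,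
      (Real.toNNReal_pos.2 (lt_min (Real.exp_pos _) (Real.exp_pos _))).ne', 0, fun u hu => ?_⟩
    have hu0 : 0 < u := (zpow_pos (by positivity) _).trans hu.1
    have h_abs : |Real.log u| ≤ Real.log r := by simpa using abs_log_le_of_mem_Ioo_zpow hr hu
    refine le_min (ENNReal.ofReal_le_ofReal ?_) (ENNReal.ofReal_le_ofReal ?_)
    · exact (min_le_left _ _).trans (exp_neg_abs_mul_le_rpow a hu0 h_abs)
    · exact (min_le_right _ _).trans (exp_neg_abs_mul_le_rpow b hu0 h_abs)

end Kernels

/-! ### The `K`-functional of a couple of weighted `L^q` spaces -/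

section KFunctional

/-- The quasi-norm of the weighted space `L^q(W dν)`. -/
def weightedLqNorm {Z : Type*} [MeasurableSpace Z] (ν : Measure Z) (q : ℝ) (W : Z → ℝ≥0∞)
    (g : Z → ℂ) : ℝ≥0∞ :=
  (∫⁻ z, ‖g z‖ₑ ^ q * W z ∂ν) ^ (1 / q)

variable {Z : Type*} [MeasurableSpace Z] {ν : Measure Z} {q : ℝ} {W W' W₀ W₁ : Z → ℝ≥0∞}
  {g φ₀ φ₁ : Z → ℂ}

theorem weightedLqNorm_mono (hq : 0 < q) (h : ∀ z, W z ≤ W' z) :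
    weightedLqNorm ν q W g ≤ weightedLqNorm ν q W' g :=
  ENNReal.rpow_le_rpow (lintegral_mono fun z => by gcongr; exact h z) (by positivity)

theorem weightedLqNorm_indicator (hq : 0 < q) (E : Set Z) (W : Z → ℝ≥0∞) (g : Z → ℂ) :
    weightedLqNorm ν q W (E.indicator g) = weightedLqNorm ν q (E.indicator W) g := by
  unfold weightedLqNorm
  congr! 3 with z
  by_cases hz : z ∈ E <;> simp [hz, hq]

theorem weightedLqNorm_indicator_le (hq : 0 < q) {E : Set Z} (h : ∀ z ∈ E, W z ≤ W' z) :
    weightedLqNorm ν q W (E.indicator g) ≤ weightedLqNorm ν q W' g := by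
  rw [weightedLqNorm_indicator hq]
  exact weightedLqNorm_mono hq fun z => indicator_apply_le (h z)

theorem const_mul_weightedLqNorm (hq : 0 < q) {c : ℝ≥0∞} (hc : c ≠ ∞) (W : Z → ℝ≥0∞) (g : Z → ℂ) :
    c * weightedLqNorm ν q W g = weightedLqNorm ν q (fun z => c ^ q * W z) g := by
  simp only [weightedLqNorm, one_div]
  simp_rw [mul_left_comm _ (c ^ q)]
  rw [lintegral_const_mul' _ _ (ENNReal.rpow_ne_top_of_nonneg hq.le hc),
    ENNReal.mul_rpow_of_nonneg _ _ (inv_nonneg.2 hq.le), ENNReal.rpow_rpow_inv hq.ne']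

theorem weightedLqNorm_eq_eLpNorm (hq : 0 < q) (hW : AEMeasurable W ν)
    (hg : AEStronglyMeasurable g ν) :
    weightedLqNorm ν q W g = eLpNorm g (ENNReal.ofReal q) (ν.withDensity W) := by
  rw [eLpNorm_eq_lintegral_rpow_enorm_toReal (ENNReal.ofReal_pos.2 hq).ne' ENNReal.ofReal_ne_top,
    ENNReal.toReal_ofReal hq.le, lintegral_withDensity_eq_lintegral_mul₀ hW (hg.enorm.pow_const q)]
  simp only [weightedLqNorm, Pi.mul_apply, mul_comm]

theorem weightedLqNorm_le_of_ae_eq_add (hq : 0 < q) (hW : AEMeasurable W ν)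
    (hφ₀ : AEStronglyMeasurable φ₀ ν) (hφ₁ : AEStronglyMeasurable φ₁ ν) (hg : g =ᵐ[ν] φ₀ + φ₁) :
    weightedLqNorm ν q W g ≤ ENNReal.LpAddConst (ENNReal.ofReal q) *
      (weightedLqNorm ν q W φ₀ + weightedLqNorm ν q W φ₁) := by
  have h_ac := withDensity_absolutelyContinuous ν W
  rw [weightedLqNorm_eq_eLpNorm hq hW ((hφ₀.add hφ₁).congr hg.symm),
    weightedLqNorm_eq_eLpNorm hq hW hφ₀, weightedLqNorm_eq_eLpNorm hq hW hφ₁,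
    eLpNorm_congr_ae (h_ac.ae_eq hg)]
  exact eLpNorm_add_le' (hφ₀.mono_ac h_ac) (hφ₁.mono_ac h_ac) _

theorem kFunctional_le (hq : 0 < q) (hW₀ : Measurable W₀) (hW₁ : Measurable W₁) (α : ℝ)
    (hg : AEStronglyMeasurable g ν) :
    kFunctional ν (weightedLqNorm ν q W₀) (weightedLqNorm ν q W₁) α g
      ≤ 2 * weightedLqNorm ν q (fun z => min (W₀ z) (ENNReal.ofReal α ^ q * W₁ z)) g := by
  -- The nearly optimal decomposition keeps `g`, at each point, in the space of smaller weight.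
  set E : Set Z := {z | W₀ z ≤ ENNReal.ofReal α ^ q * W₁ z}
  have hE : MeasurableSet E := measurableSet_le hW₀ (hW₁.const_mul _)
  have h_split : g =ᵐ[ν] E.indicator g + Eᶜ.indicator g := by rw [indicator_self_add_compl]
  calc kFunctional ν (weightedLqNorm ν q W₀) (weightedLqNorm ν q W₁) α g
      ≤ weightedLqNorm ν q W₀ (E.indicator g)
          + ENNReal.ofReal α * weightedLqNorm ν q W₁ (Eᶜ.indicator g) :=
        iInf_le_of_le _ <| iInf_le_of_le _ <| iInf_le_of_le (hg.indicator hE) <|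
          iInf_le_of_le (hg.indicator hE.compl) <| iInf_le_of_le h_split le_rfl
    _ ≤ _ := by
        rw [const_mul_weightedLqNorm hq ENNReal.ofReal_ne_top, two_mul]
        gcongr
        · exact weightedLqNorm_indicator_le hq fun z hz => (min_eq_left hz).ge
        · exact weightedLqNorm_indicator_le hq fun z hz =>
            (min_eq_right (lt_of_not_ge (show ¬W₀ z ≤ _ from hz)).le).ge

theorem le_kFunctional (hq : 0 < q) (hW₀ : Measurable W₀) (hW₁ : Measurable W₁) (α : ℝ)
    (g : Z → ℂ) :
    weightedLqNorm ν q (fun z => min (W₀ z) (ENNReal.ofReal α ^ q * W₁ z)) g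
      ≤ ENNReal.LpAddConst (ENNReal.ofReal q) *
        kFunctional ν (weightedLqNorm ν q W₀) (weightedLqNorm ν q W₁) α g := by
  have h_ne_zero : ENNReal.LpAddConst (ENNReal.ofReal q) ≠ 0 := by
    unfold ENNReal.LpAddConst
    split_ifs <;> simp
  simp only [kFunctional, ENNReal.mul_iInf_of_ne h_ne_zero (ENNReal.LpAddConst_lt_top _).ne]
  refine le_iInf fun φ₀ => le_iInf fun φ₁ => le_iInf fun hφ₀ => le_iInf fun hφ₁ =>
    le_iInf fun hg => ?_
  have hW : Measurable fun z => min (W₀ z) (ENNReal.ofReal α ^ q * W₁ z) :=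
    hW₀.min (hW₁.const_mul _)
  refine (weightedLqNorm_le_of_ae_eq_add hq hW.aemeasurable hφ₀ hφ₁ hg).trans ?_
  rw [const_mul_weightedLqNorm hq ENNReal.ofReal_ne_top]
  gcongr
  · exact weightedLqNorm_mono hq fun z => min_le_left _ _
  · exact weightedLqNorm_mono hq fun z => min_le_right _ _

theorem exists_comparable_kFunctional (ν : Measure Z) (hq : 0 < q) (hW₀ : Measurable W₀)
    (hW₁ : Measurable W₁) :
    ∃ C : ℝ≥0, ∀ (α : ℝ) (g : Z → ℂ), AEStronglyMeasurable g ν → Comparable C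
      (kFunctional ν (weightedLqNorm ν q W₀) (weightedLqNorm ν q W₁) α g)
      (weightedLqNorm ν q (fun z => min (W₀ z) (ENNReal.ofReal α ^ q * W₁ z)) g) := by
  lift ENNReal.LpAddConst (ENNReal.ofReal q) to ℝ≥0 using (ENNReal.LpAddConst_lt_top _).ne with C hC
  refine ⟨max 2 C, fun α g hg => ⟨?_, ?_⟩⟩
  · refine (kFunctional_le hq hW₀ hW₁ α hg).trans ?_
    gcongr
    exact_mod_cast le_max_left 2 C
  · refine (le_kFunctional hq hW₀ hW₁ α g).trans ?_
    rw [← hC]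
    gcongr
    exact le_max_right 2 C

end KFunctional

/-! ### Ahlfors–David regular spaces -/

theorem secondCountableTopology_of_isOpenPosMeasure {X : Type*} [PseudoMetricSpace X]
    [MeasurableSpace X] [OpensMeasurableSpace X] (μ : Measure X) [SFinite μ]
    [μ.IsOpenPosMeasure] : SecondCountableTopology X := by
  refine Metric.secondCountable_of_almost_dense_set fun ε hε => ?_
  obtain ⟨s, -, h_disjoint, h_cover⟩ := Vitali.exists_disjoint_subfamily_covering_enlargement_ball
    (univ : Set X) id (fun _ => ε / 4) (ε / 4) (fun _ _ => le_rfl) 4 (by norm_num)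
  refine ⟨s, ?_, fun x => ?_⟩
  · have h_countable := Measure.countable_meas_pos_of_disjoint_iUnion (μ := μ)
      (As := fun x : s => Metric.ball (x : X) (ε / 4)) (fun _ => measurableSet_ball)
      fun x y hxy => h_disjoint x.2 y.2 fun h => hxy (Subtype.ext h)
    have h_univ : {x : s | 0 < μ (Metric.ball (x : X) (ε / 4))} = univ :=
      eq_univ_of_forall fun x => Metric.measure_ball_pos μ _ (by positivity)
    rw [h_univ, countable_univ_iff] at h_countable
    exact countable_coe_iff.1 h_countable
  · obtain ⟨y, hy, hxy⟩ := h_cover x (mem_univ x)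
    have hx : x ∈ Metric.ball y (4 * (ε / 4)) := hxy (Metric.mem_ball_self (by positivity))
    rw [mul_div_cancel₀ _ four_ne_zero] at hx
    exact ⟨y, hy, (Metric.mem_ball.1 hx).le⟩

namespace IsADRegular

variable {X : Type*} [MetricSpace X] [MeasurableSpace X] {μ : Measure X} {n : ℝ}

theorem exists_comparable (h : IsADRegular μ n) (hX : ¬ Bornology.IsBounded (univ : Set X)) :
    ∃ C : ℝ≥0, C ≠ 0 ∧ ∀ (x : X) (r : ℝ), 0 < r →
      Comparable C (μ (Metric.ball x r)) (ENNReal.ofReal (r ^ n)) := by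
  obtain ⟨-, C, hC, H⟩ := h
  have hC0 : 0 < C := by positivity
  refine ⟨C.toNNReal, (Real.toNNReal_pos.2 hC0).ne', fun x r hr => ?_⟩
  obtain ⟨h_ge, h_le⟩ := H x r hr (by
    rw [Metric.ediam_of_unbounded hX]
    exact ENNReal.ofReal_lt_top)
  change _ ≤ ENNReal.ofReal C * _ ∧ _ ≤ ENNReal.ofReal C * _
  rw [← ENNReal.ofReal_mul hC0.le]
  refine ⟨h_le, ?_⟩
  calc ENNReal.ofReal (r ^ n) = ENNReal.ofReal C * ENNReal.ofReal (C⁻¹ * r ^ n) := by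
        rw [← ENNReal.ofReal_mul hC0.le, mul_inv_cancel_left₀ hC0.ne']
    _ ≤ _ := by gcongr

theorem measure_ball_ne_top (h : IsADRegular μ n) (hX : ¬ Bornology.IsBounded (univ : Set X))
    (x : X) (r : ℝ) : μ (Metric.ball x r) ≠ ∞ := by
  rcases le_or_gt r 0 with hr | hr
  · simp [Metric.ball_eq_empty.2 hr]
  · obtain ⟨C, -, H⟩ := h.exists_comparable hX
    exact ne_top_of_le_ne_top (ENNReal.mul_ne_top ENNReal.coe_ne_top ENNReal.ofReal_ne_top)
      (H x r hr).1

theorem isOpenPosMeasure (h : IsADRegular μ n) (hX : ¬ Bornology.IsBounded (univ : Set X)) :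
    μ.IsOpenPosMeasure := by
  obtain ⟨C, -, H⟩ := h.exists_comparable hX
  refine ⟨fun U hU ⟨x, hx⟩ hμU => ?_⟩
  obtain ⟨r, hr, hrU⟩ := Metric.isOpen_iff.1 hU x hx
  have h_le := (H x r hr).2
  rw [measure_mono_null hrU hμU, mul_zero, nonpos_iff_eq_zero, ENNReal.ofReal_eq_zero] at h_le
  exact h_le.not_gt (Real.rpow_pos_of_pos hr n)

theorem sigmaFinite (h : IsADRegular μ n) (hX : ¬ Bornology.IsBounded (univ : Set X)) :
    SigmaFinite μ := by
  obtain ⟨x⟩ : Nonempty X := by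
    by_contra h_empty
    rw [not_nonempty_iff] at h_empty
    exact hX (by simp [eq_empty_of_isEmpty])
  exact ⟨⟨⟨fun k : ℕ => Metric.ball x k, fun _ => trivial,
    fun k => (h.measure_ball_ne_top hX x k).lt_top, Metric.iUnion_ball_nat x⟩⟩⟩

theorem secondCountableTopology [OpensMeasurableSpace X] (h : IsADRegular μ n)
    (hX : ¬ Bornology.IsBounded (univ : Set X)) : SecondCountableTopology X :=
  have := h.sigmaFinite hX
  have := h.isOpenPosMeasure hX
  secondCountableTopology_of_isOpenPosMeasure μ

theorem exists_comparable_rpow (h : IsADRegular μ n) (hX : ¬ Bornology.IsBounded (univ : Set X))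
    (e : ℝ) :
    ∃ C : ℝ≥0, ∀ (x : X) (r : ℝ), 0 < r →
      Comparable C (μ (Metric.ball x r) ^ e) (ENNReal.ofReal (r ^ (n * e))) := by
  obtain ⟨C, hC, H⟩ := h.exists_comparable hX
  refine ⟨C ^ |e|, fun x r hr => ?_⟩
  rw [Real.rpow_mul hr.le, ← ENNReal.ofReal_rpow_of_pos (Real.rpow_pos_of_pos hr n)]
  exact (H x r hr).rpow hC e

theorem exists_comparable_weight (h : IsADRegular μ n)
    (hX : ¬ Bornology.IsBounded (univ : Set X)) (q s σ : ℝ) :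
    ∃ C : ℝ≥0, ∀ (y : X) (t : ℝ), 0 < t →
      Comparable C (μ (Metric.ball y t) ^ (-q * s - 1))
        (ENNReal.ofReal (t ^ (n * (σ - s) * q)) * μ (Metric.ball y t) ^ (-q * σ - 1)) := by
  obtain ⟨C, H⟩ := h.exists_comparable_rpow hX ((σ - s) * q)
  refine ⟨C, fun y t ht => ?_⟩
  have := h.isOpenPosMeasure hX
  have h_split : μ (Metric.ball y t) ^ (-q * s - 1)
      = μ (Metric.ball y t) ^ ((σ - s) * q) * μ (Metric.ball y t) ^ (-q * σ - 1) := by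
    rw [← ENNReal.rpow_add _ _ (Metric.measure_ball_pos μ y ht).ne' (h.measure_ball_ne_top hX y t)]
    ring_nf
  rw [h_split, mul_assoc n]
  simpa only [mul_one] using (H y t ht).mul (Comparable.refl _)

end IsADRegular

/-! ### Radial distributions on cones -/

section Measurability

variable {X : Type*} [MetricSpace X] [MeasurableSpace X] [OpensMeasurableSpace X]
  [SecondCountableTopology X]

theorem measurableSet_setOf_mem_cone : MeasurableSet {a : X × (X × ℝ) | a.2 ∈ cone a.1} := by
  have h_pos : MeasurableSet {a : X × (X × ℝ) | 0 < a.2.2} :=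
    measurableSet_lt measurable_const (by fun_prop)
  have h_dist : MeasurableSet {a : X × (X × ℝ) | dist a.2.1 a.1 < a.2.2} :=
    measurableSet_lt (by fun_prop) (by fun_prop)
  exact h_pos.inter h_dist

theorem measurableSet_cone (x : X) : MeasurableSet (cone x) :=
  measurable_prodMk_left measurableSet_setOf_mem_cone

theorem measurable_measure_ball (μ : Measure X) [SFinite μ] :
    Measurable fun z : X × ℝ => μ (Metric.ball z.1 z.2) := by
  have h : MeasurableSet {a : (X × ℝ) × X | dist a.2 a.1.1 < a.1.2} :=
    measurableSet_lt (by fun_prop) (by fun_prop)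
  exact measurable_measure_prodMk_left h

end Measurability

/-- The distribution, in the variable `t`, of `|f(y, t)|^q V(y, t)^{-qσ} dμ(y) / V(y, t) dt / t` on
the cone `Γ(x)`. Up to constants, all quasi-norms of the theorem depend on `f` only through these
measures. -/
def radialMeasure {X : Type*} [MetricSpace X] [MeasurableSpace X] (μ : Measure X) (q σ : ℝ)
    (f : X × ℝ → ℂ) (x : X) : Measure ℝ :=
  (((halfSpace μ).restrict (cone x)).withDensity fun z =>
    ‖f z‖ₑ ^ q * μ (Metric.ball z.1 z.2) ^ (-q * σ - 1)).map Prod.snd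

/-- The quasi-norm in which the radial distributions only enter through their masses on the layers
`[r ^ k, r ^ (k + 1))`; all quasi-norms of the theorem are compared with it. -/
def discreteNorm {X : Type*} [MetricSpace X] [MeasurableSpace X] (μ : Measure X)
    (p q σ r : ℝ) (f : X × ℝ → ℂ) : ℝ≥0∞ :=
  (∫⁻ x, ∑' k : ℤ, radialMeasure μ q σ f x (Ico (r ^ k) (r ^ (k + 1))) ^ (p / q) ∂μ) ^ (1 / p)

section RadialMeasure

variable {X : Type*} [MetricSpace X] [MeasurableSpace X] {μ : Measure X} {p q σ r : ℝ}
  {f : X × ℝ → ℂ}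

theorem radialMeasure_absolutelyContinuous [SFinite μ] (q σ : ℝ) (f : X × ℝ → ℂ) (x : X) :
    radialMeasure μ q σ f x ≪ dtOverT :=
  (((withDensity_absolutelyContinuous _ _).trans
    Measure.restrict_le_self.absolutelyContinuous).map measurable_snd).trans
    Measure.quasiMeasurePreserving_snd.absolutelyContinuous

theorem ae_radialMeasure_pos [SFinite μ] (q σ : ℝ) (f : X × ℝ → ℂ) (x : X) :
    ∀ᵐ t ∂radialMeasure μ q σ f x, 0 < t :=
  (radialMeasure_absolutelyContinuous q σ f x).ae_le ae_dtOverT_pos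

theorem IsLayerKernel.exists_comparable_discreteNorm [SFinite μ] {φ : ℝ → ℝ≥0∞}
    (h : IsLayerKernel r φ) (hr : 1 < r) (hp : 0 < p) (hq : 0 < q) (σ : ℝ) :
    ∃ C : ℝ≥0, ∀ f : X × ℝ → ℂ, Comparable C
      ((∫⁻ x, ∫⁻ τ, (∫⁻ t, φ (t / τ) ∂radialMeasure μ q σ f x) ^ (p / q) ∂dtOverT ∂μ) ^ (1 / p))
      (discreteNorm μ p q σ r f) := by
  obtain ⟨C, hC⟩ := h.exists_comparable hr (div_pos hp hq)
  exact ⟨C ^ (1 / p), fun f => (Comparable.lintegral (Eventually.of_forall fun x =>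
    hC _ (ae_radialMeasure_pos q σ f x))).rpow_of_nonneg (by positivity)⟩

variable [OpensMeasurableSpace X] [SecondCountableTopology X] [SFinite μ]

theorem MemL0.aemeasurable_density (hf : MemL0 μ f) (q σ : ℝ) :
    AEMeasurable (fun z => ‖f z‖ₑ ^ q * μ (Metric.ball z.1 z.2) ^ (-q * σ - 1)) (halfSpace μ) :=
  (hf.enorm.pow_const q).mul ((measurable_measure_ball μ).pow_const _).aemeasurable

theorem lintegral_radialMeasure (hf : MemL0 μ f) (q σ : ℝ) (x : X) {g : ℝ → ℝ≥0∞}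
    (hg : Measurable g) :
    ∫⁻ t, g t ∂radialMeasure μ q σ f x
      = ∫⁻ z in cone x, ‖f z‖ₑ ^ q * μ (Metric.ball z.1 z.2) ^ (-q * σ - 1) * g z.2
        ∂halfSpace μ := by
  rw [radialMeasure, lintegral_map hg measurable_snd]
  exact lintegral_withDensity_eq_lintegral_mul₀ (hf.aemeasurable_density q σ).restrict
    (hg.comp measurable_snd).aemeasurable

instance : SFinite (halfSpace μ) := by
  unfold halfSpace
  infer_instance

theorem MemL0.measurable_lintegral_radialMeasure {Y : Type*} [MeasurableSpace Y]
    (hf : MemL0 μ f) (q σ : ℝ) {g : Y → ℝ → ℝ≥0∞} (hg : Measurable (Function.uncurry g)) :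
    Measurable fun a : Y × X => ∫⁻ t, g a.1 t ∂radialMeasure μ q σ f a.2 := by
  obtain ⟨w, hw, hfw⟩ := hf.aemeasurable_density q σ
  have h_cone : MeasurableSet {b : (Y × X) × (X × ℝ) | b.2 ∈ cone b.1.2} :=
    (show Measurable fun b : (Y × X) × (X × ℝ) => (b.1.2, b.2) by fun_prop)
      measurableSet_setOf_mem_cone
  have h_integrand : Measurable ({b : (Y × X) × (X × ℝ) | b.2 ∈ cone b.1.2}.indicator
      fun b => w b.2 * g b.1.1 b.2.2) :=
    ((hw.comp measurable_snd).mul (hg.comp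
      (show Measurable fun b : (Y × X) × (X × ℝ) => (b.1.1, b.2.2) by fun_prop))).indicator h_cone
  convert h_integrand.lintegral_prod_right' (ν := halfSpace μ) using 2 with a
  calc ∫⁻ t, g a.1 t ∂radialMeasure μ q σ f a.2
      = ∫⁻ z in cone a.2, w z * g a.1 z.2 ∂halfSpace μ := by
        rw [lintegral_radialMeasure hf q σ a.2 hg.of_uncurry_left]
        exact lintegral_congr_ae ((ae_restrict_of_ae hfw).mono fun z hz => by simp only [hz])
    _ = _ := (lintegral_indicator (measurableSet_cone a.2) _).symm

theorem MemL0.lintegral_radialMeasure_swap {Y : Type*} [MeasurableSpace Y] {ρ : Measure Y}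
    [SFinite ρ] (hf : MemL0 μ f) (q σ : ℝ) {g : Y → ℝ → ℝ≥0∞}
    (hg : Measurable (Function.uncurry g)) (P : ℝ) :
    ∫⁻ y, ∫⁻ x, (∫⁻ t, g y t ∂radialMeasure μ q σ f x) ^ P ∂μ ∂ρ
      = ∫⁻ x, ∫⁻ y, (∫⁻ t, g y t ∂radialMeasure μ q σ f x) ^ P ∂ρ ∂μ :=
  lintegral_lintegral_swap
    ((hf.measurable_lintegral_radialMeasure q σ hg).pow_const P).aemeasurable

theorem MemL0.measurable_radialMeasure_apply (hf : MemL0 μ f) (q σ : ℝ) {S : Set ℝ}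
    (hS : MeasurableSet S) : Measurable fun x => radialMeasure μ q σ f x S := by
  have h := hf.measurable_lintegral_radialMeasure q σ (Y := Unit)
    (g := fun _ => S.indicator 1) ((measurable_one.indicator hS).comp measurable_snd)
  simpa only [Function.comp_def, lintegral_indicator_one hS] using
    h.comp (measurable_prodMk_left (x := ()))

theorem comparable_weightedLqNorm_cone (hf : MemL0 μ f) (hq : 0 < q) {W : X × ℝ → ℝ≥0∞}
    {m : ℝ → ℝ≥0∞} (hm : Measurable m) {C : ℝ≥0}
    (h : ∀ z : X × ℝ, 0 < z.2 →
      Comparable C (W z) (m z.2 * μ (Metric.ball z.1 z.2) ^ (-q * σ - 1))) (x : X) :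
    Comparable (C ^ (1 / q)) (weightedLqNorm (halfSpace μ) q W ((cone x).indicator f))
      ((∫⁻ t, m t ∂radialMeasure μ q σ f x) ^ (1 / q)) := by
  refine Comparable.rpow_of_nonneg ?_ (by positivity)
  rw [lintegral_radialMeasure hf q σ x hm, ← lintegral_indicator (measurableSet_cone x)]
  refine Comparable.lintegral (Eventually.of_forall fun z => ?_)
  by_cases hz : z ∈ cone x
  · rw [indicator_of_mem hz, indicator_of_mem hz, mul_assoc, mul_comm (_ ^ (-q * σ - 1))]
    exact (h z hz.1).mul_left _
  · simp [hz, hq, Comparable]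

end RadialMeasure

/-! ### The quasi-norms in terms of radial distributions -/

theorem lpNorm_rpow {Z : Type*} [MeasurableSpace Z] (ν : Measure Z) {p : ℝ} (hp : 0 < p)
    (g : Z → ℝ≥0∞) : lpNorm ν p g ^ p = ∫⁻ z, g z ^ p ∂ν := by
  rw [lpNorm, ← ENNReal.rpow_mul, one_div_mul_cancel hp.ne', ENNReal.rpow_one]

theorem mul_rpow_one_div_rpow {p q : ℝ} (hp : 0 < p) (hq : 0 < q) (c a : ℝ≥0∞) :
    (c * a ^ (1 / q)) ^ p = (c ^ q * a) ^ (p / q) := by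
  have hpq : 0 ≤ p / q := by positivity
  rw [ENNReal.mul_rpow_of_nonneg _ _ hp.le, ENNReal.mul_rpow_of_nonneg _ _ hpq,
    ← ENNReal.rpow_mul, ← ENNReal.rpow_mul, one_div_mul_eq_div, mul_div_cancel₀ _ hq.ne']

theorem ofReal_rpow_neg_rpow_mul {t τ q : ℝ} (ht : 0 < t) (hτ : 0 < τ) (e : ℝ) :
    ENNReal.ofReal (τ ^ (-e)) ^ q * ENNReal.ofReal (t ^ (e * q))
      = ENNReal.ofReal ((t / τ) ^ (e * q)) := by
  rw [ENNReal.ofReal_rpow_of_pos (by positivity), ← ENNReal.ofReal_mul (by positivity),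
    ← Real.rpow_mul hτ.le, neg_mul, Real.rpow_neg hτ.le, Real.div_rpow ht.le hτ.le,
    inv_mul_eq_div]

theorem ofReal_rpow_neg_rpow_mul_min {t τ q : ℝ} (ht : 0 < t) (hτ : 0 < τ) (e₀ e₁ : ℝ) :
    ENNReal.ofReal (τ ^ (-e₀)) ^ q * min (ENNReal.ofReal (t ^ (e₀ * q)))
        (ENNReal.ofReal (τ ^ (e₀ - e₁)) ^ q * ENNReal.ofReal (t ^ (e₁ * q)))
      = min (ENNReal.ofReal ((t / τ) ^ (e₀ * q))) (ENNReal.ofReal ((t / τ) ^ (e₁ * q))) := by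
  have h_mul : ENNReal.ofReal (τ ^ (-e₀)) ^ q * ENNReal.ofReal (τ ^ (e₀ - e₁)) ^ q
      = ENNReal.ofReal (τ ^ (-e₁)) ^ q := by
    rw [← ENNReal.mul_rpow_of_ne_top ENNReal.ofReal_ne_top ENNReal.ofReal_ne_top,
      ← ENNReal.ofReal_mul (by positivity), ← Real.rpow_add hτ, neg_add_eq_sub, sub_sub_cancel_left]
  rw [mul_min, ← mul_assoc, h_mul, ofReal_rpow_neg_rpow_mul ht hτ, ofReal_rpow_neg_rpow_mul ht hτ]

theorem comparable_ofReal_rpow_one {u M : ℝ} (hu : 0 < u) (hM : |Real.log u| ≤ M) (a : ℝ) :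
    Comparable (Real.exp (|a| * M)).toNNReal (ENNReal.ofReal (u ^ a)) 1 := by
  have h_le := exp_neg_abs_mul_le_rpow (-a) hu hM
  have h_ge := exp_neg_abs_mul_le_rpow a hu hM
  rw [abs_neg, Real.exp_neg, Real.rpow_neg hu.le, inv_le_inv₀ (by positivity) (by positivity)]
    at h_le
  rw [Real.exp_neg, inv_le_iff_one_le_mul₀' (by positivity)] at h_ge
  change _ ≤ ENNReal.ofReal _ * 1 ∧ 1 ≤ ENNReal.ofReal _ * _
  rw [mul_one, ← ENNReal.ofReal_mul (by positivity), ENNReal.one_le_ofReal]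
  exact ⟨ENNReal.ofReal_le_ofReal h_le, h_ge⟩

theorem exists_comparable_setLIntegral_layer {r : ℝ} (hr : 1 < r) (q e : ℝ) :
    ∃ C : ℝ≥0, ∀ ν : Measure ℝ, ν ≪ dtOverT → ∀ k : ℤ, Comparable C
      (∫⁻ t in ENNReal.ofReal ⁻¹' Ioo (ENNReal.ofReal (r ^ k)) (ENNReal.ofReal (r ^ (k + 1))),
        ENNReal.ofReal ((r ^ (k + 1)) ^ (-e)) ^ q * ENNReal.ofReal (t ^ (e * q)) ∂ν)
      (ν (Ico (r ^ k) (r ^ (k + 1)))) := by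
  refine ⟨(Real.exp (|e * q| * (2 * Real.log r))).toNNReal, fun ν hν k => ?_⟩
  have h_pos (j : ℤ) : 0 < r ^ j := zpow_pos (by positivity) j
  have h_preimage : ENNReal.ofReal ⁻¹' Ioo (ENNReal.ofReal (r ^ k)) (ENNReal.ofReal (r ^ (k + 1)))
      = Ioo (r ^ k) (r ^ (k + 1)) := by
    ext t
    simp only [mem_preimage, mem_Ioo, ENNReal.ofReal_lt_ofReal_iff (h_pos (k + 1)),
      ENNReal.ofReal_lt_ofReal_iff_of_nonneg (h_pos k).le]
  have h_ae : Ioo (r ^ k) (r ^ (k + 1)) =ᵐ[ν] Ico (r ^ k) (r ^ (k + 1)) := by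
    filter_upwards [hν.ae_le (ae_dtOverT_ne (r ^ k))] with t ht
    exact propext (and_congr_left fun _ => ht.symm.le_iff_lt.symm)
  rw [h_preimage, setLIntegral_congr h_ae, ← setLIntegral_one]
  refine Comparable.lintegral (ae_restrict_of_forall_mem measurableSet_Ico fun t ht => ?_)
  have ht0 : 0 < t := (h_pos k).trans_le ht.1
  have h_next : r ^ (k + 1) ∈ Ico (r ^ (k + 1)) (r ^ (k + 1 + 1)) :=
    left_mem_Ico.2 (zpow_lt_zpow_right₀ hr (lt_add_one _))
  have h_log : |Real.log (t / r ^ (k + 1))| ≤ 2 * Real.log r := by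
    have h := abs_log_le_of_mem_Ioo_zpow hr (div_mem_Ioo_of_mem_Ico_zpow hr ht h_next)
    simpa [abs_of_pos (Real.log_pos hr), two_mul] using h
  rw [ofReal_rpow_neg_rpow_mul ht0 (h_pos _)]
  exact comparable_ofReal_rpow_one (div_pos ht0 (h_pos _)) h_log _

namespace IsADRegular

variable {X : Type*} [MetricSpace X] [MeasurableSpace X] [OpensMeasurableSpace X]
  {μ : Measure X} {n p q r s₀ s₁ θ : ℝ}

theorem lusin_volPow (h : IsADRegular μ n) (hX : ¬ Bornology.IsBounded (univ : Set X))
    (hq : 0 < q) (s : ℝ) (f : X × ℝ → ℂ) (x : X) :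
    lusin μ q (volPow μ (-s) f) x = lqsNorm μ q s ((cone x).indicator f) := by
  have := h.secondCountableTopology hX
  have := h.isOpenPosMeasure hX
  unfold lusin lqsNorm
  rw [← lintegral_indicator (measurableSet_cone x)]
  congr! 3 with z
  by_cases hz : z ∈ cone x
  swap
  · simp [hz, hq]
  have h_pos := Metric.measure_ball_pos μ z.1 hz.1
  have h_top := h.measure_ball_ne_top hX z.1 z.2
  have h_enorm : ‖((μ.real (Metric.ball z.1 z.2) ^ (-s) : ℝ) : ℂ)‖ₑ
      = μ (Metric.ball z.1 z.2) ^ (-s) := by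
    rw [← ofReal_norm, Complex.norm_real, Real.norm_of_nonneg (by positivity), Measure.real,
      ← ENNReal.ofReal_rpow_of_pos (ENNReal.toReal_pos h_pos.ne' h_top),
      ENNReal.ofReal_toReal h_top]
  have h_exponent : -q * s - 1 = -s * q + -1 := by ring
  rw [indicator_of_mem hz, indicator_of_mem hz, volPow, enorm_mul, h_enorm,
    ENNReal.mul_rpow_of_nonneg _ _ hq.le, ← ENNReal.rpow_mul, h_exponent,
    ENNReal.rpow_add _ _ h_pos.ne' h_top, ENNReal.rpow_neg_one, div_eq_mul_inv]
  ring

theorem exists_comparable_lusin_truncate (h : IsADRegular μ n)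
    (hX : ¬ Bornology.IsBounded (univ : Set X)) (hq : 0 < q) (s σ : ℝ) :
    ∃ C : ℝ≥0, ∀ (a b : ℝ≥0∞) (f : X × ℝ → ℂ), MemL0 μ f → ∀ x,
      Comparable C (lusin μ q (volPow μ (-s) (truncate a b f)) x)
        ((∫⁻ t in ENNReal.ofReal ⁻¹' Ioo a b, ENNReal.ofReal (t ^ (n * (σ - s) * q))
          ∂radialMeasure μ q σ f x) ^ (1 / q)) := by
  have := h.secondCountableTopology hX
  have := h.sigmaFinite hX
  obtain ⟨C, hC⟩ := h.exists_comparable_weight hX q s σ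
  refine ⟨C ^ (1 / q), fun a b f hf x => ?_⟩
  have h_truncate : truncate a b f = (Prod.snd ⁻¹' (ENNReal.ofReal ⁻¹' Ioo a b)).indicator f := rfl
  have h_meas : MeasurableSet (ENNReal.ofReal ⁻¹' Ioo a b) :=
    ENNReal.measurable_ofReal measurableSet_Ioo
  rw [h.lusin_volPow hX hq, h_truncate, indicator_indicator, inter_comm, ← indicator_indicator]
  change Comparable _ (weightedLqNorm (halfSpace μ) q _ _) _
  rw [weightedLqNorm_indicator hq, ← lintegral_indicator h_meas]
  refine comparable_weightedLqNorm_cone hf hq (Measurable.indicator (by fun_prop) h_meas)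
    (fun z hz => ?_) x
  by_cases hz_mem : z.2 ∈ ENNReal.ofReal ⁻¹' Ioo a b
  · rw [indicator_of_mem hz_mem, indicator_of_mem (mem_preimage.2 hz_mem)]
    exact hC z.1 z.2 hz
  · rw [indicator_of_notMem hz_mem, indicator_of_notMem (mt mem_preimage.1 hz_mem), zero_mul]
    simp [Comparable]

theorem exists_comparable_tentNorm_truncate (h : IsADRegular μ n)
    (hX : ¬ Bornology.IsBounded (univ : Set X)) (hp : 0 < p) (hq : 0 < q) (s σ : ℝ) :
    ∃ C : ℝ≥0, ∀ (c a b : ℝ≥0∞) (f : X × ℝ → ℂ), c ≠ ∞ → MemL0 μ f →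
      Comparable C ((c * tentNorm μ p q s (truncate a b f)) ^ p)
        (∫⁻ x, (∫⁻ t in ENNReal.ofReal ⁻¹' Ioo a b, c ^ q * ENNReal.ofReal (t ^ (n * (σ - s) * q))
          ∂radialMeasure μ q σ f x) ^ (p / q) ∂μ) := by
  obtain ⟨C, hC⟩ := h.exists_comparable_lusin_truncate hX hq s σ
  refine ⟨C ^ p, fun c a b f hc hf => ?_⟩
  rw [ENNReal.mul_rpow_of_nonneg _ _ hp.le, tentNorm, lpNorm_rpow μ hp,
    ← lintegral_const_mul' _ _ (ENNReal.rpow_ne_top_of_nonneg hp.le hc)]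
  refine Comparable.lintegral (Eventually.of_forall fun x => ?_)
  rw [← ENNReal.mul_rpow_of_nonneg _ _ hp.le,
    lintegral_const_mul' _ _ (ENNReal.rpow_ne_top_of_nonneg hq.le hc),
    ← mul_rpow_one_div_rpow hp hq]
  exact ((hC a b f hf x).mul_left c).rpow_of_nonneg hp.le

theorem truncation_normEquiv (h : IsADRegular μ n) (hX : ¬ Bornology.IsBounded (univ : Set X))
    (hp : 0 < p) (hq : 0 < q) (hr : 1 < r) (s σ : ℝ) {U : Set ℝ}
    (hφ : IsLayerKernel r (U.indicator fun u => ENNReal.ofReal (u ^ (n * (σ - s) * q))))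
    (a b : ℝ → ℝ≥0∞)
    (hU : ∀ {τ t : ℝ}, 0 < τ → 0 < t → (ENNReal.ofReal t ∈ Ioo (a τ) (b τ) ↔ t / τ ∈ U)) :
    NormEquiv μ
      (fun f => lpNorm dtOverT p fun τ =>
        ENNReal.ofReal (τ ^ (-(n * (σ - s)))) * tentNorm μ p q s (truncate (a τ) (b τ) f))
      (discreteNorm μ p q σ r) := by
  have := h.secondCountableTopology hX
  have := h.sigmaFinite hX
  obtain ⟨C, hC⟩ := h.exists_comparable_tentNorm_truncate hX hp hq s σ
  obtain ⟨D, hD⟩ := hφ.exists_comparable_discreteNorm (μ := μ) hr hp hq σ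
  refine normEquiv_of_comparable (C ^ (1 / p) * D) fun f hf => Comparable.trans ?_ (hD f)
  rw [← hf.lintegral_radialMeasure_swap q σ
    (g := fun τ t => U.indicator (fun u => ENNReal.ofReal (u ^ (n * (σ - s) * q))) (t / τ))
    (hφ.measurable.comp (show Measurable fun a : ℝ × ℝ => a.2 / a.1 by fun_prop))]
  refine Comparable.rpow_of_nonneg (Comparable.lintegral ?_) (by positivity)
  filter_upwards [ae_dtOverT_pos] with τ hτ
  convert hC _ (a τ) (b τ) f ENNReal.ofReal_ne_top hf using 4 with x
  rw [← lintegral_indicator (ENNReal.measurable_ofReal measurableSet_Ioo)]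
  refine lintegral_congr_ae ((ae_radialMeasure_pos q σ f x).mono fun t ht => ?_)
  dsimp only
  by_cases ht_mem : t / τ ∈ U
  · rw [indicator_of_mem ht_mem, ← ofReal_rpow_neg_rpow_mul ht hτ,
      indicator_of_mem (show t ∈ ENNReal.ofReal ⁻¹' Ioo (a τ) (b τ) from (hU hτ ht).2 ht_mem)]
  · rw [indicator_of_notMem ht_mem, indicator_of_notMem
      (show t ∉ ENNReal.ofReal ⁻¹' Ioo (a τ) (b τ) from fun h_mem => ht_mem ((hU hτ ht).1 h_mem))]

theorem lowerTruncNorm_normEquiv (h : IsADRegular μ n)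
    (hX : ¬ Bornology.IsBounded (univ : Set X)) (hp : 0 < p) (hq : 0 < q) (hs : s₀ < s₁)
    (hθ : 0 < θ) (hr : 1 < r) :
    NormEquiv μ (lowerTruncNorm μ n p q s₀ s₁ θ)
      (discreteNorm μ p q ((1 - θ) * s₀ + θ * s₁) r) := by
  have h_exponent : n * (s₁ - s₀) * θ = n * ((1 - θ) * s₀ + θ * s₁ - s₀) := by ring
  have h_pos : 0 < n * (s₁ - s₀) * θ * q :=
    mul_pos (mul_pos (mul_pos h.1 (sub_pos.2 hs)) hθ) hq
  unfold lowerTruncNorm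
  rw [h_exponent] at h_pos ⊢
  refine h.truncation_normEquiv hX hp hq hr s₀ _ (isLayerKernel_indicator_Iio hr h_pos) _ _
    fun hτ ht => ?_
  simp only [mem_Ioo, ENNReal.ofReal_pos, ht, true_and, ENNReal.ofReal_lt_ofReal_iff hτ, mem_Iio,
    div_lt_one hτ]

theorem upperTruncNorm_normEquiv (h : IsADRegular μ n)
    (hX : ¬ Bornology.IsBounded (univ : Set X)) (hp : 0 < p) (hq : 0 < q) (hs : s₀ < s₁)
    (hθ : θ < 1) (hr : 1 < r) :
    NormEquiv μ (upperTruncNorm μ n p q s₀ s₁ θ)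
      (discreteNorm μ p q ((1 - θ) * s₀ + θ * s₁) r) := by
  have h_exponent : n * (s₁ - s₀) * (1 - θ) = -(n * ((1 - θ) * s₀ + θ * s₁ - s₁)) := by ring
  have h_pos : 0 < n * (s₁ - s₀) * (1 - θ) * q :=
    mul_pos (mul_pos (mul_pos h.1 (sub_pos.2 hs)) (sub_pos.2 hθ)) hq
  unfold upperTruncNorm
  rw [h_exponent, neg_mul, neg_pos] at h_pos
  rw [h_exponent]
  refine h.truncation_normEquiv hX hp hq hr s₁ _ (isLayerKernel_indicator_Ioi hr h_pos) _ _
    fun hτ ht => ?_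
  simp only [mem_Ioo, ENNReal.ofReal_lt_top, and_true, ENNReal.ofReal_lt_ofReal_iff ht, mem_Ioi,
    one_lt_div hτ]

theorem layerNorm_normEquiv (h : IsADRegular μ n) (hX : ¬ Bornology.IsBounded (univ : Set X))
    (hp : 0 < p) (hq : 0 < q) (s₀ s₁ θ : ℝ) (hr : 1 < r) :
    NormEquiv μ (layerNorm μ n p q s₀ s₁ θ r)
      (discreteNorm μ p q ((1 - θ) * s₀ + θ * s₁) r) := by
  have := h.secondCountableTopology hX
  have := h.sigmaFinite hX
  set σ := (1 - θ) * s₀ + θ * s₁ with hσ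
  obtain ⟨C, hC⟩ := h.exists_comparable_tentNorm_truncate hX hp hq s₀ σ
  obtain ⟨D, hD⟩ := exists_comparable_setLIntegral_layer hr q (n * (σ - s₀))
  refine normEquiv_of_comparable ((C * D ^ (p / q)) ^ (1 / p)) fun f hf =>
    Comparable.rpow_of_nonneg ?_ (by positivity)
  rw [lintegral_tsum fun k => ((hf.measurable_radialMeasure_apply q σ
    measurableSet_Ico).pow_const _).aemeasurable, ← (Equiv.addRight (1 : ℤ)).tsum_eq]
  refine Comparable.tsum fun k => ?_
  have h_coeff : r ^ (-(n * (k + 1 : ℤ) * θ * (s₁ - s₀))) = (r ^ (k + 1)) ^ (-(n * (σ - s₀))) := by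
    rw [← Real.rpow_intCast, ← Real.rpow_mul (by positivity), hσ]
    ring_nf
  simp only [Equiv.coe_addRight, add_sub_cancel_right, h_coeff]
  exact (hC _ _ _ f ENNReal.ofReal_ne_top hf).trans (Comparable.lintegral (Eventually.of_forall
    fun x => (hD _ (radialMeasure_absolutelyContinuous q σ f x) k).rpow_of_nonneg (by positivity)))

theorem exists_comparable_kFunctional_cone (h : IsADRegular μ n)
    (hX : ¬ Bornology.IsBounded (univ : Set X)) (hq : 0 < q) (s₀ s₁ σ : ℝ) :
    ∃ C : ℝ≥0, ∀ (f : X × ℝ → ℂ), MemL0 μ f → ∀ (α : ℝ) (x : X), Comparable C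
      (kFunctional (halfSpace μ) (lqsNorm μ q s₀) (lqsNorm μ q s₁) α ((cone x).indicator f))
      ((∫⁻ t, min (ENNReal.ofReal (t ^ (n * (σ - s₀) * q)))
        (ENNReal.ofReal α ^ q * ENNReal.ofReal (t ^ (n * (σ - s₁) * q)))
        ∂radialMeasure μ q σ f x) ^ (1 / q)) := by
  have := h.secondCountableTopology hX
  have := h.sigmaFinite hX
  have h_weight (s : ℝ) :
      Measurable fun z : X × ℝ => μ (Metric.ball z.1 z.2) ^ (-q * s - 1) :=
    (measurable_measure_ball μ).pow_const _
  obtain ⟨C, hC⟩ :=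
    exists_comparable_kFunctional (halfSpace μ) hq (h_weight s₀) (h_weight s₁)
  obtain ⟨D₀, hD₀⟩ := h.exists_comparable_weight hX q s₀ σ
  obtain ⟨D₁, hD₁⟩ := h.exists_comparable_weight hX q s₁ σ
  refine ⟨C * max D₀ D₁ ^ (1 / q), fun f hf α x =>
    (hC α _ (hf.indicator (measurableSet_cone x))).trans ?_⟩
  refine comparable_weightedLqNorm_cone hf hq (by fun_prop) (fun z hz => ?_) x
  rw [min_mul, mul_assoc (ENNReal.ofReal α ^ q)]
  exact (hD₀ z.1 z.2 hz).min ((hD₁ z.1 z.2 hz).mul_left _)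

theorem exists_comparable_realInterpNorm_cone (h : IsADRegular μ n)
    (hX : ¬ Bornology.IsBounded (univ : Set X)) (hp : 0 < p) (hq : 0 < q) (hs : s₀ ≠ s₁)
    {σ : ℝ} (hσ : σ = (1 - θ) * s₀ + θ * s₁) :
    ∃ C : ℝ≥0, ∀ (f : X × ℝ → ℂ), MemL0 μ f → ∀ x : X, Comparable C
      (realInterpNorm (halfSpace μ) (lqsNorm μ q s₀) (lqsNorm μ q s₁) θ p
        ((cone x).indicator f) ^ p)
      (∫⁻ τ, (∫⁻ t, min (ENNReal.ofReal ((t / τ) ^ (n * (σ - s₀) * q)))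
        (ENNReal.ofReal ((t / τ) ^ (n * (σ - s₁) * q)))
        ∂radialMeasure μ q σ f x) ^ (p / q) ∂dtOverT) := by
  have := h.secondCountableTopology hX
  have := h.sigmaFinite hX
  have hδ : n * (s₁ - s₀) ≠ 0 := mul_ne_zero h.1.ne' (sub_ne_zero.2 hs.symm)
  obtain ⟨C, hC⟩ := h.exists_comparable_kFunctional_cone hX hq s₀ s₁ σ
  set D := |n * (s₁ - s₀)|.toNNReal
  have hD0 : D ≠ 0 := (Real.toNNReal_pos.2 (abs_pos.2 hδ)).ne'
  refine ⟨max D D⁻¹ * C ^ p, fun f hf x => ?_⟩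
  rw [realInterpNorm, lpNorm_rpow _ hp, lintegral_dtOverT_comp_rpow hδ]
  refine (Comparable.const_mul hD0 _).trans
    (Comparable.lintegral (ae_dtOverT_pos.mono fun τ hτ => ?_))
  convert ((hC f hf (τ ^ (n * (s₁ - s₀))) x).mul_left _).rpow_of_nonneg hp.le using 1
  rw [mul_rpow_one_div_rpow hp hq, ← lintegral_const_mul' _ _
    (ENNReal.rpow_ne_top_of_nonneg hq.le ENNReal.ofReal_ne_top)]
  congr 1
  refine lintegral_congr_ae ((ae_radialMeasure_pos q σ f x).mono fun t ht => ?_)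
  have h_exponent : n * (s₁ - s₀) * -θ = -(n * (σ - s₀)) := by rw [hσ]; ring
  have h_diff : n * (s₁ - s₀) = n * (σ - s₀) - n * (σ - s₁) := by ring
  dsimp only
  rw [← Real.rpow_mul hτ.le, h_exponent, h_diff, ofReal_rpow_neg_rpow_mul_min ht hτ]

theorem coneInterpNorm_normEquiv (h : IsADRegular μ n)
    (hX : ¬ Bornology.IsBounded (univ : Set X)) (hp : 0 < p) (hq : 0 < q) (hs : s₀ ≠ s₁)
    (hθ₀ : 0 < θ) (hθ₁ : θ < 1) (hr : 1 < r) :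
    NormEquiv μ (coneInterpNorm μ p q s₀ s₁ θ)
      (discreteNorm μ p q ((1 - θ) * s₀ + θ * s₁) r) := by
  have := h.secondCountableTopology hX
  have := h.sigmaFinite hX
  set σ := (1 - θ) * s₀ + θ * s₁ with hσ
  have h_neg : n * (σ - s₀) * q * (n * (σ - s₁) * q) < 0 := by
    have h_pos : 0 < (n * (s₁ - s₀) * q) ^ 2 * (θ * (1 - θ)) :=
      mul_pos (sq_pos_of_ne_zero
        (mul_ne_zero (mul_ne_zero h.1.ne' (sub_ne_zero.2 hs.symm)) hq.ne'))
        (mul_pos hθ₀ (sub_pos.2 hθ₁))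
    rw [hσ]
    linarith
  obtain ⟨C, hC⟩ := h.exists_comparable_realInterpNorm_cone hX hp hq hs hσ
  obtain ⟨D, hD⟩ :=
    (isLayerKernel_min_rpow hr h_neg).exists_comparable_discreteNorm (μ := μ) hr hp hq σ
  exact normEquiv_of_comparable (C ^ (1 / p) * D) fun f hf =>
    ((Comparable.lintegral (Eventually.of_forall (hC f hf))).rpow_of_nonneg
      (by positivity)).trans (hD f)

end IsADRegular

end TentSpace

end

open TentSpace in
theorem mainTheorem6 {X : Type*} [MetricSpace X] [MeasurableSpace X] [BorelSpace X]
    (μ : MeasureTheory.Measure X) (n : ℝ) (hAD : IsADRegular μ n)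
    (hX : ¬ Bornology.IsBounded (Set.univ : Set X))
    (p₀ p₁ q s₀ s₁ θ pθ : ℝ) (hp₀ : 0 < p₀) (hp₁ : 0 < p₁) (hq : 0 < q) (hs : s₀ ≠ s₁)
    (hθ₀ : 0 < θ) (hθ₁ : θ < 1) (hpθ : pθ⁻¹ = (1 - θ) * p₀⁻¹ + θ * p₁⁻¹) :
    (s₀ < s₁ →
      NormEquiv μ (coneInterpNorm μ pθ q s₀ s₁ θ) (upperTruncNorm μ n pθ q s₀ s₁ θ) ∧
      NormEquiv μ (coneInterpNorm μ pθ q s₀ s₁ θ) (lowerTruncNorm μ n pθ q s₀ s₁ θ)) ∧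
    (s₁ < s₀ →
      NormEquiv μ (coneInterpNorm μ pθ q s₀ s₁ θ) (upperTruncNorm μ n pθ q s₁ s₀ (1 - θ)) ∧
      NormEquiv μ (coneInterpNorm μ pθ q s₀ s₁ θ) (lowerTruncNorm μ n pθ q s₁ s₀ (1 - θ))) ∧
    (∀ r : ℝ, 1 < r →
      NormEquiv μ (coneInterpNorm μ pθ q s₀ s₁ θ) (layerNorm μ n pθ q s₀ s₁ θ r)) := by
  have hθ' : 0 < 1 - θ := sub_pos.2 hθ₁
  have hp : 0 < pθ := by
    rw [← inv_pos, hpθ]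
    positivity
  have h_cone {r : ℝ} (hr : 1 < r) := hAD.coneInterpNorm_normEquiv hX hp hq hs hθ₀ hθ₁ hr
  have h_swap : (1 - θ) * s₀ + θ * s₁ = (1 - (1 - θ)) * s₁ + (1 - θ) * s₀ := by ring
  refine ⟨fun h => ⟨?_, ?_⟩, fun h => ⟨?_, ?_⟩, fun r hr => ?_⟩
  · exact (h_cone one_lt_two).trans (hAD.upperTruncNorm_normEquiv hX hp hq h hθ₁ one_lt_two).symm
  · exact (h_cone one_lt_two).trans (hAD.lowerTruncNorm_normEquiv hX hp hq h hθ₀ one_lt_two).symm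
  · refine (h_cone one_lt_two).trans ?_
    rw [h_swap]
    exact (hAD.upperTruncNorm_normEquiv hX hp hq h (sub_lt_self 1 hθ₀) one_lt_two).symm
  · refine (h_cone one_lt_two).trans ?_
    rw [h_swap]
    exact (hAD.lowerTruncNorm_normEquiv hX hp hq h hθ' one_lt_two).symm
  · exact (h_cone hr).trans (hAD.layerNorm_normEquiv hX hp hq s₀ s₁ θ hr).symm
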